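/- Let $n\ge 3$ be an integer and let $s_1,s_2\in\mathbb R$ satisfy $1<s_1<\frac n2$ and $s_2>\frac n2+1$. Let $C^\infty_{c,\mathrm{rad}}(\mathbb R^n)$ denote the space of smooth, compactly supported, radial, complex-valued functions on $\mathbb R^n$. With the Fourier transform $\mathcal Fu(\xi)=(2\pi)^{-n/2}\int_{\mathbb R^n}u(x)e^{-i\xi\cdot x}\,dx$ put, for $s>-\frac n2$, $$\langle u,v\rangle_{\dot H^s}:=\big\langle |\cdot|^s\mathcal Fu,\ |\cdot|^s\mathcal Fv\big\rangle_{L^2(\mathbb R^n)},$$ and let $\mathcal H_{s_1,s_2}$ be the Hilbert space obtained as the completion of $C^\infty_{c,\mathrm{rad}}(\mathbb R^n)\times C^\infty_{c,\mathrm{rad}}(\mathbb R^n)$ with respect to the norm induced by the inner product $$\langle(u_1,u_2),(v_1,v_2)\rangle_{\mathcal H_{s_1,s_2}}:=\langle u_1,v_1\rangle_{\dot H^{s_1}}+\langle u_1,v_1\rangle_{\dot H^{s_2}}+\langle u_2,v_2\rangle_{\dot H^{s_1-1}}+\langle u_2,v_2\rangle_{\dot H^{s_2-1}} .$$ Let $\Lambda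 f(x):=x\cdot\nabla f(x)$, and let $\widetilde{\mathbf L}_0$ be the free wave operator in similarity variables, $$\widetilde{\mathbf L}_0(u_1,u_2):=\big(-\Lambda u_1-u_1+u_2,\ \Delta u_1-\Lambda u_2-2u_2\big),\qquad \mathcal D(\widetilde{\mathbf L}_0):=C^\infty_{c,\mathrm{rad}}(\mathbb R^n)\times C^\infty_{c,\mathrm{rad}}(\mathbb R^n).$$ Then $\widetilde{\mathbf L}_0:\mathcal D(\widetilde{\mathbf L}_0)\subseteq\mathcal H_{s_1,s_2}\to\mathcal H_{s_1,s_2}$ is closable, and its closure $\mathbf L_0$ is the generator of a strongly continuous semigroup $(\mathbf S_0(\tau))_{\tau\ge0}$ of bounded operators on $\mathcal H_{s_1,s_2}$. Furthermore, $$\|\mathbf S_0(\tau)\mathbf u\|_{\mathcal H_{s_1,s_2}}\le e^{(\frac n2-1-s_1)\tau}\,\|\mathbf u\|_{\mathcal H_{s_1,s_2}}\qquad\text{for all }\mathbf u\in\mathcal H_{s_1,s_2},\ \tau\ge0 .$$ -/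

import Mathlib

open scoped ContDiff FourierTransform Topology NNReal

namespace FreeWave

/-- `ℝⁿ` with the Euclidean norm. -/
abbrev Euc (n : ℕ) : Type := EuclideanSpace ℝ (Fin n)

/-! ### Radial test functions and the differential operators -/

/-- The complex vector space of smooth, compactly supported, radial, complex-valued functions
on `ℝⁿ`. -/
def radialTest (n : ℕ) : Submodule ℂ (Euc n → ℂ) where
  carrier := {u | ContDiff ℝ ∞ u ∧ HasCompactSupport u ∧ ∀ x y, ‖x‖ = ‖y‖ → u x = u y}
  zero_mem' := ⟨contDiff_const, HasCompactSupport.zero, fun _ _ _ => rfl⟩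
  add_mem' := by
    rintro u v ⟨hu, hu', hu''⟩ ⟨hv, hv', hv''⟩
    exact ⟨hu.add hv, hu'.add hv', fun x y h => by simp [hu'' x y h, hv'' x y h]⟩
  smul_mem' := by
    rintro c u ⟨hu, hu', hu''⟩
    exact ⟨contDiff_const.smul hu, hu'.smul_left (f := fun _ => c),
      fun x y h => by simp [hu'' x y h]⟩

/-- `(Λ u)(x) = x · ∇u(x)`. -/
noncomputable def eulerField {n : ℕ} (u : Euc n → ℂ) (x : Euc n) : ℂ := fderiv ℝ u x x

theorem eulerField_mem {n : ℕ} {u : Euc n → ℂ} (hu : u ∈ radialTest n) :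
    eulerField u ∈ radialTest n := by
  obtain ⟨h1, h2, h3⟩ := hu
  refine ⟨?_, ?_, ?_⟩
  · exact (h1.fderiv_right (m := ∞) (by simp)).clm_apply contDiff_id
  · refine (h2.fderiv (𝕜 := ℝ)).mono ?_
    intro x hx hx'
    apply hx
    simp [eulerField, hx']
  · have key : ∀ x, eulerField u x = deriv (fun t : ℝ => u (t • x)) 1 := by
      intro x
      have hd : HasFDerivAt u (fderiv ℝ u x) ((1 : ℝ) • x) := by
        rw [one_smul]
        exact (h1.differentiable (by simp) x).hasFDerivAt
      have hl : HasDerivAt (fun t : ℝ => t • x) x 1 := by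
        simpa using (hasDerivAt_id (1 : ℝ)).smul_const x
      exact (hd.comp_hasDerivAt (1 : ℝ) hl).deriv.symm
    intro x y hxy
    rw [key, key]
    congr 1
    funext t
    exact h3 _ _ (by simp [norm_smul, hxy])

theorem two_le_smooth : (2 : WithTop ℕ∞) ≤ ∞ := by
  exact WithTop.coe_le_coe.mpr (le_top : (2 : ℕ∞) ≤ ⊤)

theorem laplacian_mem {n : ℕ} {u : Euc n → ℂ} (hu : u ∈ radialTest n) :
    Laplacian.laplacian u ∈ radialTest n := by
  obtain ⟨h1, h2, h3⟩ := hu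
  have hform := InnerProductSpace.laplacian_eq_iteratedFDeriv_orthonormalBasis u
    (EuclideanSpace.basisFun (Fin n) ℝ)
  refine ⟨?_, ?_, ?_⟩
  · rw [hform]
    refine ContDiff.sum fun i _ => ?_
    have := h1.iteratedFDeriv_right (i := 2) (m := ∞) le_rfl
    exact (ContinuousMultilinearMap.apply ℝ (fun _ : Fin 2 => Euc n) ℂ
      _).contDiff.comp this
  · refine (h2.iteratedFDeriv (𝕜 := ℝ) 2).mono ?_
    intro x hx hx'
    apply hx
    rw [hform]
    simp [hx']
  · intro x y hxy
    set A : Euc n ≃ₗᵢ[ℝ] Euc n := (Submodule.span ℝ {x - y})ᗮ.reflection with hA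
    have hAx : A x = y := Submodule.reflection_sub hxy
    have hcomp : u ∘ (A.toContinuousLinearEquiv : Euc n →L[ℝ] Euc n) = u := by
      funext z
      exact h3 _ _ (A.norm_map z)
    have hform' := congrFun (InnerProductSpace.laplacian_eq_iteratedFDeriv_orthonormalBasis u
      ((EuclideanSpace.basisFun (Fin n) ℝ).map A)) y
    rw [hform', hform]
    refine Finset.sum_congr rfl fun i _ => ?_
    have hx := ContinuousLinearMap.iteratedFDeriv_comp_right
      (A.toContinuousLinearEquiv : Euc n →L[ℝ] Euc n) h1 x (i := 2) two_le_smooth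
    rw [hcomp] at hx
    rw [hx, ContinuousMultilinearMap.compContinuousLinearMap_apply]
    have e : (A.toContinuousLinearEquiv : Euc n →L[ℝ] Euc n) x = y := hAx
    rw [e]
    congr 1
    funext j
    fin_cases j <;> rfl

/-- `Λ` on radial test functions. -/
noncomputable def eulerOp (n : ℕ) : radialTest n →ₗ[ℂ] radialTest n where
  toFun u := ⟨eulerField u, eulerField_mem u.2⟩
  map_add' u v := by
    ext x
    have hu := u.2.1.differentiable (by simp) x
    have hv := v.2.1.differentiable (by simp) x
    simp [eulerField, fderiv_add hu hv]
  map_smul' c u := by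
    ext x
    have hu := u.2.1.differentiable (by simp) x
    simp [eulerField, fderiv_const_smul hu c]

/-- The Laplacian on radial test functions. -/
noncomputable def laplaceOp (n : ℕ) : radialTest n →ₗ[ℂ] radialTest n where
  toFun u := ⟨Laplacian.laplacian (u : Euc n → ℂ), laplacian_mem u.2⟩
  map_add' u v := by
    ext x
    have hu := (u.2.1.of_le (m := 2) two_le_smooth).contDiffAt (x := x)
    have hv := (v.2.1.of_le (m := 2) two_le_smooth).contDiffAt (x := x)
    simpa using hu.laplacian_add hv
  map_smul' c u := by
    ext x
    have hu := (u.2.1.of_le (m := 2) two_le_smooth).contDiffAt (x := x)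
    have := hu.laplacian_CLM_comp_left (l := (c • ContinuousLinearMap.id ℝ ℂ))
    exact this

/-! ### Homogeneous Sobolev inner products -/

/-- The Fourier transform `(2π)^(-n/2) ∫ u(x) exp(-i ξ·x) dx`. -/
noncomputable def fourierT {n : ℕ} (u : Euc n → ℂ) (ξ : Euc n) : ℂ :=
  (((2 * Real.pi) ^ (-(n : ℝ) / 2) : ℝ) : ℂ) *
    ∫ x, u x * Complex.exp (-Complex.I * (inner ℝ ξ x : ℝ))

/-- The weighted Fourier transform `|ξ|^s (𝓕u)(ξ)`. -/
noncomputable def weightedFourier {n : ℕ} (s : ℝ) (u : Euc n → ℂ) (ξ : Euc n) : ℂ :=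
  ((‖ξ‖ ^ s : ℝ) : ℂ) * fourierT u ξ

/-- The homogeneous Sobolev inner product of order `s`, i.e. the `L²` inner product of
`|·|^s 𝓕u` and `|·|^s 𝓕v` (conjugate-linear in the first slot, following Mathlib). -/
noncomputable def sobolevInner {n : ℕ} (s : ℝ) (u v : Euc n → ℂ) : ℂ :=
  ∫ ξ, inner ℂ (weightedFourier s u ξ) (weightedFourier s v ξ)

theorem exists_schwartz_fourierT {n : ℕ} {u : Euc n → ℂ} (hu : u ∈ radialTest n) :
    ∃ G : SchwartzMap (Euc n) ℂ, (∀ ξ, G ξ = fourierT u ξ) ∧ (G = 0 → u = 0) := by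
  obtain ⟨h1, h2, -⟩ := hu
  have hpi : (2 * Real.pi)⁻¹ ≠ 0 := by positivity
  let e : Euc n ≃L[ℝ] Euc n := ContinuousLinearEquiv.smulLeft (Units.mk0 _ hpi)
  let f : SchwartzMap (Euc n) ℂ := h2.toSchwartzMap h1
  let c : ℂ := (((2 * Real.pi) ^ (-(n : ℝ) / 2) : ℝ) : ℂ)
  have hc : c ≠ 0 := by
    simp only [c, ne_eq, Complex.ofReal_eq_zero]
    positivity
  refine ⟨c • SchwartzMap.compCLMOfContinuousLinearEquiv ℂ e (𝓕 f), ?_, ?_⟩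
  · intro ξ
    have he : e ξ = (2 * Real.pi)⁻¹ • ξ := rfl
    rw [smul_apply, SchwartzMap.compCLMOfContinuousLinearEquiv_apply,
      Function.comp_apply, SchwartzMap.fourier_coe, he, Real.fourier_eq', smul_eq_mul, fourierT]
    congr 1
    refine MeasureTheory.integral_congr_ae (Filter.Eventually.of_forall fun x => ?_)
    have : -2 * Real.pi * inner ℝ x ((2 * Real.pi)⁻¹ • ξ) = - inner ℝ ξ x := by
      rw [inner_smul_right, real_inner_comm]
      field_simp
    simp only [this, smul_eq_mul]
    rw [mul_comm]
    congr 2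
    push_cast
    ring
  · intro h0
    have h3 : SchwartzMap.compCLMOfContinuousLinearEquiv ℂ e (𝓕 f) = 0 :=
      (smul_eq_zero.mp h0).resolve_left hc
    have h4 : 𝓕 f = 0 := by
      ext y
      have := congrArg (fun g : SchwartzMap (Euc n) ℂ => g (e.symm y)) h3
      simpa using this
    have h5 : f = 0 := by
      have := congrArg (fun g : SchwartzMap (Euc n) ℂ => 𝓕⁻ g) h4
      simpa using this
    funext x
    exact congrArg (fun g : SchwartzMap (Euc n) ℂ => g x) h5

theorem memLp_weightedFourier {n : ℕ} (hn : 0 < n) {s : ℝ} (hs : -(n : ℝ) / 2 < s)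
    {u : Euc n → ℂ} (hu : u ∈ radialTest n) :
    MeasureTheory.MemLp (weightedFourier s u) 2 := by
  obtain ⟨G, hG, -⟩ := exists_schwartz_fourierT hu
  have hwG : weightedFourier s u = fun ξ => ((‖ξ‖ ^ s : ℝ) : ℂ) * G ξ := by
    funext ξ
    rw [weightedFourier, hG]
  rw [hwG]
  have hmeas : MeasureTheory.AEStronglyMeasurable
      (fun ξ : Euc n => ((‖ξ‖ ^ s : ℝ) : ℂ) * G ξ) := by
    refine MeasureTheory.AEStronglyMeasurable.mul ?_ G.continuous.aestronglyMeasurable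
    exact (Measurable.aestronglyMeasurable (by fun_prop))
  rw [MeasureTheory.memLp_two_iff_integrable_sq_norm hmeas]
  have hmeas2 := (hmeas.norm.pow 2)
  have hfin : Module.finrank ℝ (Euc n) = n := by simp
  obtain ⟨N, hN⟩ := exists_nat_ge (max s 0 + (n + 1 : ℝ))
  obtain ⟨C, hC⟩ : ∃ C : ℝ, ∀ x, (1 + ‖x‖) ^ N * ‖G x‖ ≤ C :=
    ⟨_, fun x => by
      simpa using SchwartzMap.one_add_le_sup_seminorm_apply (𝕜 := ℝ) (m := (N, 0)) (k := N)
        (n := 0) le_rfl le_rfl G x⟩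
  have hC0 : 0 ≤ C := le_trans (by positivity) (hC 0)
  have hGC : ∀ x, ‖G x‖ ≤ C := fun x => by
    refine le_trans ?_ (hC x)
    exact le_mul_of_one_le_left (norm_nonneg _) (one_le_pow₀ (by simp))
  have hnorm : ∀ x : Euc n, ‖((‖x‖ ^ s : ℝ) : ℂ) * G x‖ = ‖x‖ ^ s * ‖G x‖ := fun x => by
    rw [norm_mul, Complex.norm_real, Real.norm_of_nonneg (by positivity)]
  have hball : MeasureTheory.IntegrableOn
      (fun x : Euc n => ‖((‖x‖ ^ s : ℝ) : ℂ) * G x‖ ^ 2) (Metric.ball 0 1) := by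
    refine MeasureTheory.integrableOn_ball_of_norm_le_rpow (C := C ^ 2) (α := -(2 * s))
      (by rw [hfin]; exact hn) (by rw [hfin]; linarith)
      (Filter.Eventually.of_forall fun x => ?_) hmeas2
    rw [Real.norm_of_nonneg (by positivity), hnorm, mul_pow, mul_comm, neg_neg,
      mul_comm 2 s, Real.rpow_mul (norm_nonneg x)]
    have : (‖x‖ ^ s) ^ (2 : ℝ) = (‖x‖ ^ s) ^ 2 := by exact_mod_cast Real.rpow_natCast _ 2
    rw [this]
    gcongr
    exact hGC x
  have hcompl : MeasureTheory.IntegrableOn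
      (fun x : Euc n => ‖((‖x‖ ^ s : ℝ) : ℂ) * G x‖ ^ 2) (Metric.ball 0 1)ᶜ := by
    have hi : MeasureTheory.Integrable
        (fun x : Euc n => C ^ 2 * (1 + ‖x‖) ^ (-((n : ℝ) + 1))) :=
      (integrable_one_add_norm (by rw [hfin]; linarith)).const_mul _
    refine MeasureTheory.Integrable.mono' hi.integrableOn hmeas2.restrict ?_
    refine (MeasureTheory.ae_restrict_iff' Metric.isOpen_ball.measurableSet.compl).mpr
      (Filter.Eventually.of_forall fun x hx => ?_)
    have hx1 : 1 ≤ ‖x‖ := by simpa using hx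
    have hpos : (0 : ℝ) < 1 + ‖x‖ := by positivity
    have hb : ‖x‖ ^ s * ‖G x‖ ≤ C * (1 + ‖x‖) ^ (-((n : ℝ) + 1)) := by
      have h1 : ‖x‖ ^ s ≤ (1 + ‖x‖) ^ (N : ℝ) * (1 + ‖x‖) ^ (-((n : ℝ) + 1)) := by
        rw [← Real.rpow_add hpos]
        calc ‖x‖ ^ s ≤ ‖x‖ ^ (max s 0) := Real.rpow_le_rpow_of_exponent_le hx1 (le_max_left _ _)
          _ ≤ (1 + ‖x‖) ^ (max s 0) :=
            Real.rpow_le_rpow (norm_nonneg x) (by linarith) (le_max_right _ _)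
          _ ≤ _ := Real.rpow_le_rpow_of_exponent_le (by linarith) (by linarith)
      calc ‖x‖ ^ s * ‖G x‖
          ≤ ((1 + ‖x‖) ^ (N : ℝ) * (1 + ‖x‖) ^ (-((n : ℝ) + 1))) * ‖G x‖ := by gcongr
        _ = ((1 + ‖x‖) ^ N * ‖G x‖) * (1 + ‖x‖) ^ (-((n : ℝ) + 1)) := by
            rw [Real.rpow_natCast]; ring
        _ ≤ _ := by gcongr; exact hC x
    rw [Real.norm_of_nonneg (by positivity), hnorm]
    calc (‖x‖ ^ s * ‖G x‖) ^ 2 ≤ (C * (1 + ‖x‖) ^ (-((n : ℝ) + 1))) ^ 2 := by gcongr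
      _ = C ^ 2 * ((1 + ‖x‖) ^ (-((n : ℝ) + 1)) * (1 + ‖x‖) ^ (-((n : ℝ) + 1))) := by ring
      _ ≤ C ^ 2 * ((1 + ‖x‖) ^ (-((n : ℝ) + 1)) * 1) := by
          gcongr
          exact Real.rpow_le_one_of_one_le_of_nonpos (by linarith) (by linarith)
      _ = _ := by ring
  have := hball.union hcompl
  rwa [Set.union_compl_self, MeasureTheory.integrableOn_univ] at this

theorem weightedFourier_add {n : ℕ} (s : ℝ) {u v : Euc n → ℂ} (hu : u ∈ radialTest n)
    (hv : v ∈ radialTest n) :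
    weightedFourier s (u + v) = weightedFourier s u + weightedFourier s v := by
  have hint : ∀ {w : Euc n → ℂ}, w ∈ radialTest n → ∀ ξ : Euc n, MeasureTheory.Integrable
      (fun x => w x * Complex.exp (-Complex.I * (inner ℝ ξ x : ℝ))) := by
    rintro w ⟨h1, h2, -⟩ ξ
    refine Continuous.integrable_of_hasCompactSupport ?_ h2.mul_right
    have := h1.continuous
    fun_prop
  funext ξ
  simp only [weightedFourier, fourierT, Pi.add_apply, add_mul]
  rw [MeasureTheory.integral_add (hint hu ξ) (hint hv ξ)]
  ring

theorem weightedFourier_smul {n : ℕ} (s : ℝ) (c : ℂ) (u : Euc n → ℂ) :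
    weightedFourier s (c • u) = c • weightedFourier s u := by
  funext ξ
  simp only [weightedFourier, fourierT, Pi.smul_apply, smul_eq_mul, mul_assoc]
  rw [MeasureTheory.integral_const_mul]
  ring

theorem sobolevInner_conj_symm {n : ℕ} (s : ℝ) (u v : Euc n → ℂ) :
    (starRingEnd ℂ) (sobolevInner s v u) = sobolevInner s u v := by
  rw [sobolevInner, ← integral_conj]
  simp only [inner_conj_symm, sobolevInner]

theorem sobolevInner_self {n : ℕ} (s : ℝ) (u : Euc n → ℂ) :
    sobolevInner s u u = ((∫ ξ, ‖weightedFourier s u ξ‖ ^ 2 : ℝ) : ℂ) := by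
  rw [sobolevInner, ← integral_complex_ofReal]
  refine MeasureTheory.integral_congr_ae (Filter.Eventually.of_forall fun ξ => ?_)
  simp [inner_self_eq_norm_sq_to_K]

theorem sobolevInner_add_left {n : ℕ} (hn : 0 < n) {s : ℝ} (hs : -(n : ℝ) / 2 < s)
    {u v w : Euc n → ℂ} (hu : u ∈ radialTest n) (hv : v ∈ radialTest n)
    (hw : w ∈ radialTest n) :
    sobolevInner s (u + v) w = sobolevInner s u w + sobolevInner s v w := by
  have hint : ∀ {f : Euc n → ℂ}, f ∈ radialTest n → MeasureTheory.Integrable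
      (fun ξ => inner ℂ (weightedFourier s f ξ) (weightedFourier s w ξ)) := by
    intro f hf
    have hf' := memLp_weightedFourier hn hs hf
    have hw' := memLp_weightedFourier hn hs hw
    refine (MeasureTheory.L2.integrable_inner (𝕜 := ℂ) (hf'.toLp _) (hw'.toLp _)).congr ?_
    filter_upwards [hf'.coeFn_toLp, hw'.coeFn_toLp] with ξ h1 h2
    rw [h1, h2]
  simp only [sobolevInner, weightedFourier_add s hu hv, Pi.add_apply, inner_add_left]
  exact MeasureTheory.integral_add (hint hu) (hint hv)

theorem sobolevInner_smul_left {n : ℕ} (s : ℝ) (c : ℂ) (u v : Euc n → ℂ) :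
    sobolevInner s (c • u) v = (starRingEnd ℂ) c * sobolevInner s u v := by
  simp only [sobolevInner, weightedFourier_smul, Pi.smul_apply, inner_smul_left]
  exact MeasureTheory.integral_const_mul _ _

theorem eq_zero_of_integral_eq_zero {n : ℕ} (hn : 0 < n) {s : ℝ} (hs : -(n : ℝ) / 2 < s)
    {u : Euc n → ℂ} (hu : u ∈ radialTest n)
    (h : ∫ ξ, ‖weightedFourier s u ξ‖ ^ 2 = 0) : u = 0 := by
  have : Nonempty (Fin n) := ⟨⟨0, hn⟩⟩
  have hmem := memLp_weightedFourier hn hs hu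
  have hae := (MeasureTheory.integral_eq_zero_iff_of_nonneg (fun ξ => by positivity)
    ((MeasureTheory.memLp_two_iff_integrable_sq_norm hmem.1).mp hmem)).mp h
  obtain ⟨G, hG, hG0⟩ := exists_schwartz_fourierT hu
  apply hG0
  have hGae : (G : Euc n → ℂ) =ᵐ[MeasureTheory.volume] fun _ => 0 := by
    have h0 : ∀ᵐ ξ : Euc n, ξ ≠ 0 := by
      simp [MeasureTheory.ae_iff]
    filter_upwards [hae, h0] with ξ h1 h2
    have h3 : (‖ξ‖ ^ s : ℝ) ≠ 0 := (Real.rpow_pos_of_pos (norm_pos_iff.mpr h2) s).ne'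
    have h4 : weightedFourier s u ξ = 0 := by simpa using h1
    rw [weightedFourier, mul_eq_zero, Complex.ofReal_eq_zero] at h4
    rw [hG]
    exact h4.resolve_left h3
  have := G.continuous.ae_eq_iff_eq MeasureTheory.volume continuous_const |>.mp hGae
  ext ξ
  exact congrFun this ξ

/-! ### The space `H_{s₁,s₂}` -/

/-- The range of parameters in which the inner product of `H_{s₁,s₂}` is finite on test
functions. -/
structure Admissible (n : ℕ) (s₁ s₂ : ℝ) : Prop where
  dim_pos : 0 < n
  lt₁ : -(n : ℝ) / 2 + 1 < s₁
  lt₂ : -(n : ℝ) / 2 + 1 < s₂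

/-- Pairs of radial test functions. A separate type, so that it can carry the norm of
`H_{s₁,s₂}`. -/
def TestPair {n : ℕ} {s₁ s₂ : ℝ} (_h : Admissible n s₁ s₂) : Type :=
  radialTest n × radialTest n

variable {n : ℕ} {s₁ s₂ : ℝ}

instance (h : Admissible n s₁ s₂) : AddCommGroup (TestPair h) :=
  inferInstanceAs (AddCommGroup (radialTest n × radialTest n))

instance (h : Admissible n s₁ s₂) : Module ℂ (TestPair h) :=
  inferInstanceAs (Module ℂ (radialTest n × radialTest n))

/-- The inner product of `H_{s₁,s₂}` on pairs of radial test functions. -/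
noncomputable def pairInner {h : Admissible n s₁ s₂} (u v : TestPair h) : ℂ :=
  (sobolevInner s₁ (u.1 : Euc n → ℂ) v.1 + sobolevInner s₂ (u.1 : Euc n → ℂ) v.1) +
    (sobolevInner (s₁ - 1) (u.2 : Euc n → ℂ) v.2 + sobolevInner (s₂ - 1) (u.2 : Euc n → ℂ) v.2)

@[reducible]
noncomputable def pairCore (h : Admissible n s₁ s₂) :
    InnerProductSpace.Core ℂ (TestPair h) where
  inner := pairInner
  conj_inner_symm u v := by
    simp only [pairInner, map_add, sobolevInner_conj_symm]
  re_inner_nonneg u := by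
    simp only [pairInner, sobolevInner_self, ← Complex.ofReal_add]
    rw [RCLike.re_eq_complex_re, Complex.ofReal_re]
    positivity
  add_left u v w := by
    have h1 := h.lt₁
    have h2 := h.lt₂
    have e1 := sobolevInner_add_left h.dim_pos (s := s₁) (by linarith) u.1.2 v.1.2 w.1.2
    have e2 := sobolevInner_add_left h.dim_pos (s := s₂) (by linarith) u.1.2 v.1.2 w.1.2
    have e3 := sobolevInner_add_left h.dim_pos (s := s₁ - 1) (by linarith) u.2.2 v.2.2 w.2.2
    have e4 := sobolevInner_add_left h.dim_pos (s := s₂ - 1) (by linarith) u.2.2 v.2.2 w.2.2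
    have f1 : (((u + v).1 : radialTest n) : Euc n → ℂ) = u.1 + v.1 := rfl
    have f2 : (((u + v).2 : radialTest n) : Euc n → ℂ) = u.2 + v.2 := rfl
    simp only [pairInner, f1, f2, e1, e2, e3, e4]
    ring
  smul_left u v c := by
    have f1 : (((c • u).1 : radialTest n) : Euc n → ℂ) = c • (u.1 : Euc n → ℂ) := rfl
    have f2 : (((c • u).2 : radialTest n) : Euc n → ℂ) = c • (u.2 : Euc n → ℂ) := rfl
    simp only [pairInner, f1, f2, sobolevInner_smul_left]
    ring
  definite u hu := by
    have h1 := h.lt₁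
    have h2 := h.lt₂
    simp only [pairInner, sobolevInner_self, ← Complex.ofReal_add, Complex.ofReal_eq_zero] at hu
    have p : ∀ (s : ℝ) (f : Euc n → ℂ), 0 ≤ ∫ ξ, ‖weightedFourier s f ξ‖ ^ 2 :=
      fun s f => by positivity
    have p1 := p s₁ u.1
    have p2 := p s₂ u.1
    have p3 := p (s₁ - 1) u.2
    have p4 := p (s₂ - 1) u.2
    refine Prod.ext (Subtype.ext ?_) (Subtype.ext ?_)
    · exact eq_zero_of_integral_eq_zero h.dim_pos (s := s₁) (by linarith) u.1.2 (by linarith)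
    · exact eq_zero_of_integral_eq_zero h.dim_pos (s := s₁ - 1) (by linarith) u.2.2 (by linarith)

noncomputable instance (h : Admissible n s₁ s₂) : NormedAddCommGroup (TestPair h) :=
  (pairCore h).toNormedAddCommGroup

noncomputable instance (h : Admissible n s₁ s₂) : InnerProductSpace ℂ (TestPair h) :=
  InnerProductSpace.ofCore (pairCore h).toCore

/-- The Hilbert space `H_{s₁,s₂}`: the completion of the pairs of radial test functions. -/
abbrev EnergySpace (h : Admissible n s₁ s₂) : Type :=
  UniformSpace.Completion (TestPair h)

/-! ### The free wave operator in similarity variables -/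

/-- `(u₁, u₂) ↦ (-Λ u₁ - u₁ + u₂, Δ u₁ - Λ u₂ - 2 u₂)` on pairs of radial test functions. -/
noncomputable def waveOpTest (h : Admissible n s₁ s₂) : TestPair h →ₗ[ℂ] TestPair h where
  toFun u := (-eulerOp n u.1 - u.1 + u.2, laplaceOp n u.1 - eulerOp n u.2 - (2 : ℂ) • u.2)
  map_add' u v := by
    refine Prod.ext ?_ ?_
    · change -eulerOp n (u.1 + v.1) - (u.1 + v.1) + (u.2 + v.2) =
        (-eulerOp n u.1 - u.1 + u.2) + (-eulerOp n v.1 - v.1 + v.2)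
      rw [map_add]
      abel
    · change laplaceOp n (u.1 + v.1) - eulerOp n (u.2 + v.2) - (2 : ℂ) • (u.2 + v.2) =
        (laplaceOp n u.1 - eulerOp n u.2 - (2 : ℂ) • u.2) +
          (laplaceOp n v.1 - eulerOp n v.2 - (2 : ℂ) • v.2)
      rw [map_add, map_add, smul_add]
      abel
  map_smul' c u := by
    refine Prod.ext ?_ ?_
    · change -eulerOp n (c • u.1) - c • u.1 + c • u.2 = c • (-eulerOp n u.1 - u.1 + u.2)
      rw [map_smul]
      module
    · change laplaceOp n (c • u.1) - eulerOp n (c • u.2) - (2 : ℂ) • (c • u.2) =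
        c • (laplaceOp n u.1 - eulerOp n u.2 - (2 : ℂ) • u.2)
      rw [map_smul, map_smul]
      module

/-- The embedding of the pairs of radial test functions into `H_{s₁,s₂}`. -/
noncomputable def testEmb (h : Admissible n s₁ s₂) : TestPair h →ₗ[ℂ] EnergySpace h :=
  (UniformSpace.Completion.toComplₗᵢ (𝕜 := ℂ) (E := TestPair h)).toLinearMap

theorem testEmb_injective (h : Admissible n s₁ s₂) : Function.Injective (testEmb h) :=
  (UniformSpace.Completion.toComplₗᵢ (𝕜 := ℂ) (E := TestPair h)).injective

/-- The free wave operator in similarity variables as an unbounded operator on `H_{s₁,s₂}` whose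
domain is the space of pairs of radial test functions. -/
noncomputable def freeWaveOp (h : Admissible n s₁ s₂) :
    EnergySpace h →ₗ.[ℂ] EnergySpace h where
  domain := LinearMap.range (testEmb h)
  toFun := testEmb h ∘ₗ waveOpTest h ∘ₗ
    (LinearEquiv.ofInjective (testEmb h) (testEmb_injective h)).symm.toLinearMap

theorem freeWaveOp_apply (h : Admissible n s₁ s₂) (u : TestPair h) :
    freeWaveOp h ⟨testEmb h u, LinearMap.mem_range_self _ u⟩ = testEmb h (waveOpTest h u) := by
  change testEmb h (waveOpTest h ((LinearEquiv.ofInjective (testEmb h)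
    (testEmb_injective h)).symm (LinearEquiv.ofInjective (testEmb h)
    (testEmb_injective h) u))) = _
  rw [LinearEquiv.symm_apply_apply]

/-! ### Strongly continuous semigroups -/

/-- A strongly continuous one-parameter semigroup of bounded operators. -/
structure IsC0Semigroup {X : Type*} [NormedAddCommGroup X] [NormedSpace ℂ X]
    (S : ℝ≥0 → X →L[ℂ] X) : Prop where
  zero : S 0 = ContinuousLinearMap.id ℂ X
  add : ∀ σ τ, S (σ + τ) = (S σ).comp (S τ)
  continuous : ∀ x, Continuous fun τ => S τ x

/-- `A` is the infinitesimal generator of `S`: the domain of `A` consists of all `x` for which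
the right derivative of `τ ↦ S τ x` at `0` exists, and `A x` is this derivative. -/
def IsGenerator {X : Type*} [NormedAddCommGroup X] [NormedSpace ℂ X]
    (S : ℝ≥0 → X →L[ℂ] X) (A : X →ₗ.[ℂ] X) : Prop :=
  ∀ x y, (x, y) ∈ A.graph ↔
    Filter.Tendsto (fun τ : ℝ≥0 => (((τ : ℝ) : ℂ)⁻¹) • (S τ x - x)) (𝓝[>] 0) (𝓝 y)

theorem Admissible.of_bounds (hn : 3 ≤ n) (hs₁ : 1 < s₁) (hs₂ : (n : ℝ) / 2 + 1 < s₂) :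
    Admissible n s₁ s₂ := by
  have : (3 : ℝ) ≤ n := by exact_mod_cast hn
  exact ⟨by omega, by linarith, by linarith⟩

end FreeWave

/-! Under the Fourier transform `Λ` becomes `-(n + ξ·∇)` and `Δ` becomes `-|ξ|²`, so the operator is
a dilation field plus a 2×2 coupling. For each `s ∈ {s₁, s₂}` and `σ = ±1` the combination `f_σ =
(|ξ|^s û₁ - iσ|ξ|^(s-1) û₂)/√2` decouples and evolves explicitly: `f_σ(τ, ξ) = e^((n-1-s)τ)
e^(iσ(e^τ-1)|ξ|) f_σ(0, e^τ ξ)`. The phase is unimodular and the dilation costs `e^(-nτ/2)` in `L²`,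
so each mode is scaled by `e^((n/2-1-s)τ)`; as `s ≥ s₁` and `τ ≥ 0`, the worst rate is the one
claimed. By the parallelogram law the four modes embed the energy space isometrically into `L²(ℝⁿ;
ℂ⁴)` (`energyEmb`), where the semigroup law and the growth bound are read off.

The modes are not independent, so it must still be shown that the evolution preserves the image of
the energy space, and that its generator is the closure of the given operator and not a larger
extension. Both rest on `freqCore`, the radial Fourier data that are smooth with compact support
away from the origin. It is invariant, by the sine and cosine form of the evolution
(`evolFun_modelFun`); it is dense in the image (`modelMap_mem_closure_freqCore`); and its elements
are graph-norm limits of test pairs, because truncations of a Schwartz function converge in the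
Schwartz topology (`exists_tendsto_of_freqCore`).

With the derivative of the evolution on Schwartz data (`tendsto_quotient_modelMap`), a core theorem
(`isGenerator_closure_of_invariant`) concludes. It avoids resolvents: membership in the generator is
encoded by the closed condition `S_t x - x = ∫₀ᵗ S_s y ds`. -/

namespace FreeWave

/-! ### Semigroups, generators and invariant cores -/

section Semigroup

variable {X : Type*} [NormedAddCommGroup X] [NormedSpace ℂ X] {S : ℝ≥0 → X →L[ℂ] X}

open Filter in
theorem tendsto_coe_nnreal_punctured :
    Tendsto (fun τ : ℝ≥0 => (τ : ℝ)) (𝓝[>] 0) (𝓝[>] 0) := by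
  refine tendsto_nhdsWithin_iff.mpr ⟨?_, ?_⟩
  · exact (NNReal.continuous_coe.tendsto' 0 0 rfl).mono_left nhdsWithin_le_nhds
  · filter_upwards [self_mem_nhdsWithin] with τ hτ
    exact hτ

/-- A semigroup of exponentially bounded operators that is right continuous at `0` on a dense set
is strongly continuous. -/
theorem continuous_orbit_of_dense (h0 : S 0 = ContinuousLinearMap.id ℂ X)
    (hadd : ∀ σ τ, S (σ + τ) = (S σ).comp (S τ)) {β : ℝ}
    (hb : ∀ τ x, ‖S τ x‖ ≤ Real.exp (β * τ) * ‖x‖) {D : Set X} (hD : Dense D)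
    (hD0 : ∀ x ∈ D, Filter.Tendsto (fun τ => S τ x) (𝓝[>] 0) (𝓝 x)) (x : X) :
    Continuous fun τ => S τ x := by
  -- A bound uniform on bounded time intervals, whatever the sign of `β`.
  have hb' : ∀ {R : ℝ} {τ : ℝ≥0} (y : X), (τ : ℝ) ≤ R → ‖S τ y‖ ≤ Real.exp (|β| * R) * ‖y‖ := by
    intro R τ y hτ
    refine (hb τ y).trans ?_
    gcongr
    exact le_abs_self β
  have right : ∀ ε > 0, ∃ δ > 0, ∀ τ : ℝ≥0, (τ : ℝ) < δ → ‖S τ x - x‖ < ε := by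
    intro ε hε
    set C := Real.exp (|β| * 1)
    have hC : 0 < C := Real.exp_pos _
    -- The radius makes the two approximation errors, `C‖x - y‖` and `‖x - y‖`, sum to less than `ε
    -- / 2`.
    obtain ⟨y, hyD, hy⟩ := Metric.dense_iff.mp hD x (ε / (2 * (C + 1))) (by positivity)
    rw [Metric.mem_ball, dist_eq_norm] at hyD
    have h1 := Metric.tendsto_nhds.mp (hD0 y hy) (ε / 2) (by positivity)
    obtain ⟨δ, hδ, h2⟩ := Metric.eventually_nhds_iff.mp (eventually_nhdsWithin_iff.mp h1)
    refine ⟨min δ 1, by positivity, fun τ hτ => ?_⟩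
    have h3 : ‖S τ y - y‖ < ε / 2 := by
      rcases (eq_zero_or_pos τ) with h | h
      · rw [h, h0]
        simpa using hε
      · rw [← dist_eq_norm]
        refine h2 ?_ h
        rw [NNReal.dist_eq]
        simpa using hτ.trans_le (min_le_left _ _)
    have h4 : ‖S τ (x - y)‖ ≤ C * ‖x - y‖ := hb' _ (hτ.le.trans (min_le_right _ _))
    have h5 : ‖x - y‖ * (2 * (C + 1)) < ε := by
      rw [norm_sub_rev]
      exact (lt_div_iff₀ (by positivity)).mp hyD
    have h6 : S τ x - x = S τ (x - y) + (S τ y - y) + (y - x) := by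
      rw [map_sub]; abel
    have h7 := norm_add₃_le (a := S τ (x - y)) (b := S τ y - y) (c := y - x)
    rw [← h6, norm_sub_rev y x] at h7
    nlinarith
  rw [Metric.continuous_iff]
  intro τ ε hε
  set C := Real.exp (|β| * (τ + 1))
  have hC : 0 < C := Real.exp_pos _
  obtain ⟨δ, hδ, h⟩ := right (ε / C) (by positivity)
  -- Taking `ρ` to be the smaller of the two times gives continuity from the left as well as from
  -- the right.
  have key : ∀ ρ σ : ℝ≥0, (ρ : ℝ) ≤ τ + 1 → (σ : ℝ) < δ → ‖S (ρ + σ) x - S ρ x‖ < ε := by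
    intro ρ σ hρ hσ
    have : S (ρ + σ) x - S ρ x = S ρ (S σ x - x) := by rw [hadd, map_sub]; rfl
    rw [this]
    calc ‖S ρ (S σ x - x)‖ ≤ C * ‖S σ x - x‖ := hb' _ hρ
      _ < C * (ε / C) := by gcongr; exact h σ hσ
      _ = ε := by field_simp
  refine ⟨min δ 1, by positivity, fun σ hσ => ?_⟩
  rw [NNReal.dist_eq] at hσ
  have hσ1 := hσ.trans_le (min_le_left _ _)
  have hσ2 := hσ.trans_le (min_le_right _ _)
  rw [abs_lt] at hσ1 hσ2
  rcases le_total τ σ with hle | hle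
  · obtain ⟨d, rfl⟩ := exists_add_of_le hle
    rw [dist_eq_norm]
    push_cast at hσ1
    exact key τ d (by linarith) (by linarith)
  · obtain ⟨d, rfl⟩ := exists_add_of_le hle
    rw [dist_eq_norm, norm_sub_rev]
    push_cast at hσ1 key
    exact key σ d (by linarith [d.2]) (by linarith)

/-- The fundamental theorem of calculus at time `0`, where the integrand equals `y`. With its
converse below, it turns the generator into a condition that is visibly closed in `(x, y)`. -/
theorem tendsto_quotient_of_eq_integral [CompleteSpace X] {x y : X}
    (h0 : S 0 = ContinuousLinearMap.id ℂ X)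
    (hc : Continuous fun τ => S τ y)
    (h : ∀ t : ℝ≥0, S t x - x = ∫ s in (0 : ℝ)..t, S s.toNNReal y) :
    Filter.Tendsto (fun τ : ℝ≥0 => (((τ : ℝ) : ℂ)⁻¹) • (S τ x - x)) (𝓝[>] 0) (𝓝 y) := by
  have hc' : Continuous fun s : ℝ => S s.toNNReal y := hc.comp continuous_real_toNNReal
  have hd := (hc'.integral_hasStrictDerivAt 0 0).hasDerivAt
  rw [hasDerivAt_iff_tendsto_slope] at hd
  have := hd.comp (tendsto_coe_nnreal_punctured.mono_right
    (nhdsWithin_mono _ (fun r (hr : 0 < r) => hr.ne')))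
  simp only [Real.toNNReal_zero, h0, ContinuousLinearMap.id_apply] at this
  refine this.congr fun τ => ?_
  simp only [Function.comp_apply, slope_def_module, intervalIntegral.integral_same, sub_zero, h]
  rw [← Complex.ofReal_inv, Complex.coe_smul]

theorem eq_integral_of_tendsto_quotient [CompleteSpace X] {x y : X}
    (h0 : S 0 = ContinuousLinearMap.id ℂ X)
    (hadd : ∀ σ τ, S (σ + τ) = (S σ).comp (S τ))
    (hc : ∀ z, Continuous fun τ => S τ z)
    (h : Filter.Tendsto (fun τ : ℝ≥0 => (((τ : ℝ) : ℂ)⁻¹) • (S τ x - x)) (𝓝[>] 0) (𝓝 y))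
    (t : ℝ≥0) : S t x - x = ∫ s in (0 : ℝ)..t, S s.toNNReal y := by
  have hc' : ∀ z, Continuous fun s : ℝ => S s.toNNReal z := fun z =>
    (hc z).comp continuous_real_toNNReal
  -- Right derivatives suffice here, and the semigroup law carries the one at `0` to every `s`: `S_r
  -- x - S_s x = S_s (S_(r-s) x - x)`.
  have key := intervalIntegral.integral_eq_sub_of_hasDeriv_right (a := 0) (b := (t : ℝ))
    (f := fun s : ℝ => S s.toNNReal x) (f' := fun s : ℝ => S s.toNNReal y) (hc' x).continuousOn
    ?_ ((hc' y).intervalIntegrable _ _)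
  · rw [key]
    simp [h0]
  · intro s hs
    have hs0 : 0 ≤ s := by
      rw [min_eq_left (NNReal.coe_nonneg t)] at hs
      exact hs.1.le
    rw [hasDerivWithinAt_iff_tendsto_slope' (by simp)]
    have h1 : Filter.Tendsto (fun r : ℝ => (r - s).toNNReal) (𝓝[>] s) (𝓝[>] 0) := by
      refine tendsto_nhdsWithin_iff.mpr ⟨?_, ?_⟩
      · refine Filter.Tendsto.mono_left ?_ nhdsWithin_le_nhds
        exact (continuous_real_toNNReal.comp (continuous_id.sub continuous_const)).tendsto' s 0
          (by simp)
      · filter_upwards [self_mem_nhdsWithin] with r hr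
        exact Real.toNNReal_pos.mpr (sub_pos.mpr hr)
    refine (((S s.toNNReal).continuous.tendsto y).comp (h.comp h1)).congr' ?_
    filter_upwards [self_mem_nhdsWithin] with r hr
    have hr' : s < r := hr
    have e : r.toNNReal = s.toNNReal + (r - s).toNNReal := by
      rw [← Real.toNNReal_add hs0 (by linarith)]
      congr 1
      ring
    simp only [Function.comp_apply, slope_def_module, e, hadd, ContinuousLinearMap.comp_apply]
    rw [Real.coe_toNNReal _ (by linarith), map_smul, map_sub, ← Complex.ofReal_inv,
      Complex.coe_smul]

/-- The integrated orbit depends continuously on the initial value. -/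
theorem continuous_integral_orbit [CompleteSpace X]
    (hc : ∀ z, Continuous fun τ => S τ z) {β : ℝ}
    (hb : ∀ τ x, ‖S τ x‖ ≤ Real.exp (β * τ) * ‖x‖) (t : ℝ≥0) :
    Continuous fun x => ∫ s in (0 : ℝ)..t, S s.toNNReal x := by
  have hc' : ∀ z, Continuous fun s : ℝ => S s.toNNReal z := fun z =>
    (hc z).comp continuous_real_toNNReal
  refine (LipschitzWith.of_dist_le_mul (K := Real.toNNReal (Real.exp (|β| * t) * t))
    fun x y => ?_).continuous
  rw [dist_eq_norm, dist_eq_norm, ← intervalIntegral.integral_sub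
    ((hc' x).intervalIntegrable _ _) ((hc' y).intervalIntegrable _ _)]
  have := intervalIntegral.norm_integral_le_of_norm_le_const (a := 0) (b := (t : ℝ))
    (f := fun s : ℝ => S s.toNNReal x - S s.toNNReal y)
    (C := Real.exp (|β| * t) * ‖x - y‖) ?_
  · refine this.trans_eq ?_
    rw [sub_zero, abs_of_nonneg (NNReal.coe_nonneg t)]
    rw [Real.coe_toNNReal _ (by positivity)]
    ring
  · intro s hs
    rw [Set.uIoc_of_le (NNReal.coe_nonneg t)] at hs
    rw [← map_sub]
    refine (hb _ _).trans ?_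
    rw [Real.coe_toNNReal _ hs.1.le]
    gcongr
    · exact hs.1.le
    · exact le_abs_self β
    · exact hs.2

/-- Core criterion: if the difference quotients of `S` converge to `A` on the dense domain of `A`
and the domain of the closure of `A` contains a dense `S`-invariant set, then the closure of `A`
generates `S`. -/
theorem isGenerator_closure_of_invariant [CompleteSpace X]
    (h0 : S 0 = ContinuousLinearMap.id ℂ X)
    (hadd : ∀ σ τ, S (σ + τ) = (S σ).comp (S τ)) {β : ℝ}
    (hb : ∀ τ x, ‖S τ x‖ ≤ Real.exp (β * τ) * ‖x‖) {A : X →ₗ.[ℂ] X}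
    (hA : Dense (A.domain : Set X))
    (hAS : ∀ x y, (x, y) ∈ A.graph →
      Filter.Tendsto (fun τ : ℝ≥0 => (((τ : ℝ) : ℂ)⁻¹) • (S τ x - x)) (𝓝[>] 0) (𝓝 y))
    {D : Set X} (hD : Dense D) (hDS : ∀ τ, ∀ x ∈ D, S τ x ∈ D)
    (hDA : ∀ x ∈ D, ∃ y, (x, y) ∈ A.graph.topologicalClosure) :
    IsC0Semigroup S ∧ A.IsClosable ∧ IsGenerator S A.closure := by
  have hc : ∀ x, Continuous fun τ => S τ x := by
    -- On the domain of `A`, `S_τ x` is `x` plus `τ` times a convergent difference quotient.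
    refine continuous_orbit_of_dense h0 hadd hb hA fun x hx => ?_
    have h1 := hAS x (A ⟨x, hx⟩) (A.mem_graph ⟨x, hx⟩)
    have h2 : Filter.Tendsto (fun τ : ℝ≥0 => ((τ : ℝ) : ℂ)) (𝓝[>] 0) (𝓝 0) := by
      refine Filter.Tendsto.mono_left ?_ nhdsWithin_le_nhds
      exact (Complex.continuous_ofReal.comp NNReal.continuous_coe).tendsto' 0 0 (by simp)
    have h3 := (h2.smul h1).add_const x
    rw [zero_smul, zero_add] at h3
    refine h3.congr' ?_
    filter_upwards [self_mem_nhdsWithin] with τ hτ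
    have hτ' : ((τ : ℝ) : ℂ) ≠ 0 := by
      have : τ ≠ 0 := ne_of_gt hτ
      exact_mod_cast this
    rw [smul_inv_smul₀ hτ', sub_add_cancel]
  -- The graph of the generator in integrated form; its closedness gives closability and one of the
  -- two inclusions.
  let G : Set (X × X) := {p | ∀ t : ℝ≥0, S t p.1 - p.1 = ∫ s in (0 : ℝ)..t, S s.toNNReal p.2}
  have hG : IsClosed G := by
    have : G = ⋂ t : ℝ≥0, {p : X × X | S t p.1 - p.1 = ∫ s in (0 : ℝ)..t, S s.toNNReal p.2} := by
      ext; simp [G]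
    rw [this]
    refine isClosed_iInter fun t => isClosed_eq (by fun_prop) ?_
    exact (continuous_integral_orbit hc hb t).comp continuous_snd
  have hGiff : ∀ x y, (x, y) ∈ G ↔
      Filter.Tendsto (fun τ : ℝ≥0 => (((τ : ℝ) : ℂ)⁻¹) • (S τ x - x)) (𝓝[>] 0) (𝓝 y) :=
    fun x y => ⟨fun h => tendsto_quotient_of_eq_integral h0 (hc y) h,
      fun h => eq_integral_of_tendsto_quotient h0 hadd hc h⟩
  have hcl : ∀ p ∈ A.graph.topologicalClosure, p ∈ G := by
    intro p hp
    have hsub : (A.graph : Set (X × X)) ⊆ G := fun q hq => (hGiff q.1 q.2).mpr (hAS q.1 q.2 hq)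
    exact closure_minimal hsub hG hp
  have huniq : ∀ x y z, (x, y) ∈ G → (x, z) ∈ G → y = z := fun x y z hy hz =>
    tendsto_nhds_unique ((hGiff x y).mp hy) ((hGiff x z).mp hz)
  have hclosable : A.IsClosable := by
    refine ⟨A.graph.topologicalClosure.toLinearPMap, ?_⟩
    rw [Submodule.toLinearPMap_graph_eq]
    rintro ⟨x, y⟩ hx hx0
    simp only at hx0
    subst hx0
    refine huniq 0 y 0 (hcl _ hx) ?_
    intro t
    simp
  have hmul : ∀ x y, (x, y) ∈ G → ∀ s : ℝ≥0, (S s x, S s y) ∈ G := by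
    intro x y h s
    rw [hGiff] at h ⊢
    refine (((S s).continuous.tendsto y).comp h).congr fun τ => ?_
    simp only [Function.comp_apply, map_smul, map_sub]
    rw [← ContinuousLinearMap.comp_apply, ← ContinuousLinearMap.comp_apply, ← hadd, ← hadd,
      add_comm]
  -- The reverse inclusion: time averages of every orbit lie in the domain of the closure. For `x ∈
  -- D` this follows by integrating along the orbit; both components are continuous in `x`, so
  -- density of `D` gives all `x`.
  have hint : ∀ (t : ℝ≥0) (x : X), (∫ s in (0 : ℝ)..t, S s.toNNReal x, S t x - x) ∈
      A.graph.topologicalClosure := by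
    intro t
    refine hD.induction (P := fun x => (∫ s in (0 : ℝ)..t, S s.toNNReal x, S t x - x) ∈
      A.graph.topologicalClosure) ?_ ?_
    · intro x hx
      obtain ⟨y, hy⟩ := hDA x hx
      have hxy := hcl _ hy
      have hmem : ∀ s : ℝ≥0, (S s x, S s y) ∈ A.graph.topologicalClosure := by
        intro s
        obtain ⟨z, hz⟩ := hDA _ (hDS s x hx)
        -- Invariance of `D` only provides some second component `z`; uniqueness in `G` forces `z =
        -- S_s y`.
        rwa [huniq _ _ _ (hmul x y hxy s) (hcl _ hz)]
      have hc' : ∀ z, Continuous fun s : ℝ => S s.toNNReal z := fun z =>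
        (hc z).comp continuous_real_toNNReal
      have hI : (∫ s in (0 : ℝ)..t, (S s.toNNReal x, S s.toNNReal y)) =
          (∫ s in (0 : ℝ)..t, S s.toNNReal x, S t x - x) := by
        rw [hxy t]
        simp only [intervalIntegral.integral_of_le (NNReal.coe_nonneg t)]
        exact integral_pair
          ((hc' x).intervalIntegrable 0 t).1 ((hc' y).intervalIntegrable 0 t).1
      rw [← hI]
      let V := A.graph.topologicalClosure
      have : CompleteSpace V := A.graph.isClosed_topologicalClosure.completeSpace_coe
      let f : ℝ → V := fun s => ⟨(S s.toNNReal x, S s.toNNReal y), hmem _⟩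
      have hf : Continuous f := ((hc' x).prodMk (hc' y)).subtype_mk _
      -- The curve stays in the complete subspace `V`, hence so does its integral.
      have := V.subtypeL.intervalIntegral_comp_comm
        (hf.intervalIntegrable (μ := MeasureTheory.volume) 0 t)
      change (∫ s in (0 : ℝ)..t, V.subtypeL (f s)) ∈ V
      rw [this]
      exact Subtype.property _
    · exact A.graph.isClosed_topologicalClosure.preimage
        ((continuous_integral_orbit hc hb t).prodMk (by fun_prop))
  refine ⟨⟨h0, hadd, hc⟩, hclosable, fun x y => ?_⟩
  rw [← hclosable.graph_closure_eq_closure_graph, ← hGiff]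
  refine ⟨hcl _, fun h => ?_⟩
  -- Dividing the averaged pairs by `τ` and letting `τ → 0` recovers `(x, y)`.
  have h1 : Filter.Tendsto (fun τ : ℝ≥0 => (((τ : ℝ) : ℂ)⁻¹) •
      ((∫ s in (0 : ℝ)..τ, S s.toNNReal x, S τ x - x) : X × X)) (𝓝[>] 0) (𝓝 (x, y)) := by
    refine Filter.Tendsto.prodMk_nhds ?_ ((hGiff x y).mp h)
    have hc' : Continuous fun s : ℝ => S s.toNNReal x := (hc x).comp continuous_real_toNNReal
    have hd := (hc'.integral_hasStrictDerivAt 0 0).hasDerivAt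
    rw [hasDerivAt_iff_tendsto_slope] at hd
    have := hd.comp (tendsto_coe_nnreal_punctured.mono_right
      (nhdsWithin_mono _ (fun r (hr : 0 < r) => hr.ne')))
    simp only [Real.toNNReal_zero, h0, ContinuousLinearMap.id_apply] at this
    refine this.congr fun τ => ?_
    simp only [Function.comp_apply, slope_def_module, intervalIntegral.integral_same, sub_zero]
    rw [← Complex.ofReal_inv, Complex.coe_smul]
  exact A.graph.isClosed_topologicalClosure.mem_of_tendsto h1
    (Filter.Eventually.of_forall fun τ => Submodule.smul_mem _ _ (hint τ x))

end Semigroup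

/-! ### The diagonalised evolution on `L²(ℝⁿ; ℂ⁴)` -/

section Model

open MeasureTheory

/-- Dominated convergence for the integral of `‖F i - g‖²`. The representatives `F i` are kept
separate so that bounds and limits can be checked on explicit formulas. -/
theorem tendsto_Lp_two_of_dominated {α ι V : Type*} [MeasurableSpace α] {μ : Measure α}
    [NormedAddCommGroup V] {l : Filter ι} [l.IsCountablyGenerated]
    {f : ι → Lp V 2 μ} {g : Lp V 2 μ} {F : ι → α → V} (hF : ∀ i, f i =ᵐ[μ] F i)
    {bound : α → ℝ} (hbound : MemLp bound 2 μ)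
    (hle : ∀ᶠ i in l, ∀ᵐ x ∂μ, ‖F i x - g x‖ ≤ bound x)
    (hlim : ∀ᵐ x ∂μ, Filter.Tendsto (fun i => F i x) l (𝓝 (g x))) :
    Filter.Tendsto f l (𝓝 g) := by
  rw [Lp.tendsto_Lp_iff_tendsto_eLpNorm']
  have hcongr : ∀ i, eLpNorm (⇑(f i) - ⇑g) 2 μ =
      (∫⁻ x, ‖f i x - g x‖ₑ ^ (2 : ℝ) ∂μ) ^ (1 / (2 : ℝ)) := by
    intro i
    rw [eLpNorm_eq_lintegral_rpow_enorm_toReal (by simp) (by simp)]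
    simp
  simp only [hcongr]
  have hI : Filter.Tendsto (fun i => ∫⁻ x, ‖f i x - g x‖ₑ ^ (2 : ℝ) ∂μ) l
      (𝓝 (∫⁻ _, 0 ∂μ)) := by
    have h1 : Filter.Tendsto (fun i => ∫⁻ x, ‖F i x - g x‖ₑ ^ (2 : ℝ) ∂μ) l (𝓝 (∫⁻ _, 0 ∂μ)) := by
      refine tendsto_lintegral_filter_of_dominated_convergence'
        (fun x => ‖bound x‖ₑ ^ (2 : ℝ)) (Filter.Eventually.of_forall fun i => ?_) ?_ ?_ ?_
      · have : AEStronglyMeasurable (F i) μ := (Lp.aestronglyMeasurable (f i)).congr (hF i)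
        exact ((this.sub (Lp.aestronglyMeasurable g)).enorm).pow_const _
      · filter_upwards [hle] with i hi
        filter_upwards [hi] with x hx
        gcongr
        exact enorm_le_iff_norm_le.mpr (hx.trans (le_abs_self _))
      · have := lintegral_rpow_enorm_lt_top_of_eLpNorm_lt_top (by simp) (by simp) hbound.2
        simpa using this.ne
      · filter_upwards [hlim] with x hx
        have h2 : Filter.Tendsto (fun i => ‖F i x - g x‖ₑ) l (𝓝 0) := by
          have := (hx.sub_const (g x)).enorm
          simpa using this
        have := h2.ennrpow_const (2 : ℝ)
        simpa using this
    refine h1.congr fun i => lintegral_congr_ae ?_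
    filter_upwards [hF i] with x hx
    rw [hx]
  have := hI.ennrpow_const (1 / (2 : ℝ))
  simpa using this

variable {n : ℕ}

/-- The Jacobian of the dilation is `e^(nτ)`, and the square root in the `L²` norm halves the
exponent. -/
theorem memLp_comp_dilation {V : Type*} [NormedAddCommGroup V] (τ : ℝ) {f : Euc n → V}
    (hf : MemLp f 2) :
    MemLp (fun ξ => f (Real.exp τ • ξ)) 2 ∧
      eLpNorm (fun ξ => f (Real.exp τ • ξ)) 2 volume =
        ENNReal.ofReal (Real.exp (-(n / 2) * τ)) * eLpNorm f 2 volume := by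
  have hr : Real.exp τ ≠ 0 := (Real.exp_pos τ).ne'
  have hmap := Measure.map_addHaar_smul (volume : Measure (Euc n)) hr
  have hms : AEStronglyMeasurable f (Measure.map (Real.exp τ • ·) (volume : Measure (Euc n))) := by
    rw [hmap]
    exact hf.1.smul_measure _
  have hmeas : AEMeasurable (fun ξ : Euc n => Real.exp τ • ξ) :=
    (measurable_const_smul _).aemeasurable
  have h1 : eLpNorm (fun ξ => f (Real.exp τ • ξ)) 2 volume =
        ENNReal.ofReal (Real.exp (-(n / 2) * τ)) * eLpNorm f 2 volume := by
    have := eLpNorm_map_measure (p := 2) hms hmeas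
    rw [hmap, eLpNorm_smul_measure_of_ne_top (by simp)] at this
    change eLpNorm (f ∘ fun ξ => Real.exp τ • ξ) 2 volume = _
    rw [← this, smul_eq_mul]
    congr 1
    rw [ENNReal.ofReal_rpow_of_nonneg (by positivity) (by simp)]
    congr 1
    rw [abs_of_pos (by positivity), finrank_euclideanSpace_fin, ← Real.exp_nat_mul, ← Real.exp_neg,
      ← Real.exp_mul]
    congr 1
    simp
    ring
  refine ⟨⟨hms.comp_aemeasurable hmeas, ?_⟩, h1⟩
  rw [h1]
  exact ENNReal.mul_lt_top (by simp) hf.2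

/-- The fibre of the diagonalised model: a Sobolev weight and a sign of propagation. -/
abbrev Fib : Type := EuclideanSpace ℂ (Bool × Bool)

/-- The Sobolev exponent of a mode. -/
def modeExp (s₁ s₂ : ℝ) (k : Bool × Bool) : ℝ := if k.1 then s₁ else s₂

/-- The direction of propagation of a mode. -/
def modeSign (k : Bool × Bool) : ℝ := if k.2 then 1 else -1

theorem modeSign_sq (k : Bool × Bool) : modeSign k * modeSign k = 1 := by
  unfold modeSign
  split_ifs <;> norm_num

theorem le_modeExp {s₁ s₂ : ℝ} (hs : s₁ ≤ s₂) (k : Bool × Bool) : s₁ ≤ modeExp s₁ s₂ k := by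
  unfold modeExp
  split_ifs <;> linarith

theorem modeExp_le {s₁ s₂ : ℝ} (hs : s₁ ≤ s₂) (k : Bool × Bool) : modeExp s₁ s₂ k ≤ s₂ := by
  unfold modeExp
  split_ifs <;> linarith

/-- The multiplier of the free evolution in similarity variables. -/
noncomputable def evolMult (s₁ s₂ τ : ℝ) (ξ : Euc n) (k : Bool × Bool) : ℂ :=
  Complex.exp ((((n - 1 - modeExp s₁ s₂ k) * τ : ℝ) : ℂ) +
    ((modeSign k * ((Real.exp τ - 1) * ‖ξ‖) : ℝ) : ℂ) * Complex.I)

theorem norm_evolMult (s₁ s₂ τ : ℝ) (ξ : Euc n) (k : Bool × Bool) :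
    ‖evolMult s₁ s₂ τ ξ k‖ = Real.exp ((n - 1 - modeExp s₁ s₂ k) * τ) := by
  rw [evolMult, Complex.norm_exp]
  congr 1
  rw [Complex.add_re, Complex.ofReal_re, Complex.re_ofReal_mul, Complex.I_re, mul_zero, add_zero]

/-- The cocycle identity behind the semigroup law; the phases match because `e^(σ+τ) - 1 = (e^σ - 1)
+ (e^τ - 1) e^σ`. -/
theorem evolMult_add (s₁ s₂ σ τ : ℝ) (ξ : Euc n) (k : Bool × Bool) :
    evolMult s₁ s₂ (σ + τ) ξ k =
      evolMult s₁ s₂ σ ξ k * evolMult s₁ s₂ τ (Real.exp σ • ξ) k := by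
  rw [evolMult, evolMult, evolMult, ← Complex.exp_add, norm_smul, Real.norm_eq_abs, Real.abs_exp,
    Real.exp_add]
  congr 1
  push_cast
  ring

theorem continuous_evolMult (s₁ s₂ τ : ℝ) (k : Bool × Bool) :
    Continuous fun ξ : Euc n => evolMult s₁ s₂ τ ξ k := by
  unfold evolMult
  fun_prop

/-- The free evolution in similarity variables on functions with values in the modes. -/
noncomputable def evolFun (s₁ s₂ τ : ℝ) (f : Euc n → Fib) (ξ : Euc n) : Fib :=
  WithLp.toLp 2 fun k => evolMult s₁ s₂ τ ξ k * f (Real.exp τ • ξ) k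

@[simp]
theorem evolFun_apply (s₁ s₂ τ : ℝ) (f : Euc n → Fib) (ξ : Euc n) (k : Bool × Bool) :
    evolFun s₁ s₂ τ f ξ k = evolMult s₁ s₂ τ ξ k * f (Real.exp τ • ξ) k := rfl

/-- The phases have modulus one, and for `τ ≥ 0` the smallest exponent `s₁` gives the largest
factor. -/
theorem norm_evolFun_le {s₁ s₂ : ℝ} (hs : s₁ ≤ s₂) {τ : ℝ} (hτ : 0 ≤ τ) (f : Euc n → Fib)
    (ξ : Euc n) :
    ‖evolFun s₁ s₂ τ f ξ‖ ≤ Real.exp ((n - 1 - s₁) * τ) * ‖f (Real.exp τ • ξ)‖ := by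
  refine le_of_sq_le_sq ?_ (by positivity)
  rw [mul_pow, EuclideanSpace.norm_sq_eq, EuclideanSpace.norm_sq_eq, Finset.mul_sum]
  refine Finset.sum_le_sum fun k _ => ?_
  rw [evolFun_apply, norm_mul, mul_pow, norm_evolMult]
  have := le_modeExp hs k
  gcongr

theorem memLp_evolFun {s₁ s₂ : ℝ} (hs : s₁ ≤ s₂) {τ : ℝ} (hτ : 0 ≤ τ) {f : Euc n → Fib}
    (hf : MemLp f 2) :
    MemLp (evolFun s₁ s₂ τ f) 2 ∧ eLpNorm (evolFun s₁ s₂ τ f) 2 volume ≤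
      ENNReal.ofReal (Real.exp ((n / 2 - 1 - s₁) * τ)) * eLpNorm f 2 volume := by
  obtain ⟨h1, h2⟩ := memLp_comp_dilation τ hf
  have hle : eLpNorm (evolFun s₁ s₂ τ f) 2 volume ≤
      ENNReal.ofReal (Real.exp ((n / 2 - 1 - s₁) * τ)) * eLpNorm f 2 volume := by
    have := eLpNorm_le_mul_eLpNorm_of_ae_le_mul (f := evolFun s₁ s₂ τ f)
      (Filter.Eventually.of_forall (norm_evolFun_le hs hτ f)) 2 (μ := volume)
    refine this.trans_eq ?_
    rw [h2, ← mul_assoc, ← ENNReal.ofReal_mul (by positivity), ← Real.exp_add]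
    congr 3
    ring
  refine ⟨⟨?_, hle.trans_lt (ENNReal.mul_lt_top (by simp) hf.2)⟩, hle⟩
  refine (PiLp.continuous_toLp 2 _).comp_aestronglyMeasurable ?_
  refine (aemeasurable_pi_iff.mpr fun k => ?_).aestronglyMeasurable
  refine (continuous_evolMult s₁ s₂ τ k).measurable.aemeasurable.mul ?_
  exact ((PiLp.continuous_apply 2 _ k).comp_aestronglyMeasurable h1.1).aemeasurable

theorem evolFun_congr_ae {s₁ s₂ τ : ℝ} {f g : Euc n → Fib} (h : f =ᵐ[volume] g) :
    evolFun s₁ s₂ τ f =ᵐ[volume] evolFun s₁ s₂ τ g := by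
  have := (Measure.quasiMeasurePreserving_smul (volume : Measure (Euc n))
    (Real.exp_pos τ).ne').ae_eq h
  filter_upwards [this] with ξ hξ
  have heq : f (Real.exp τ • ξ) = g (Real.exp τ • ξ) := hξ
  ext k
  simp [heq]

/-- The state space of the diagonalised model. -/
abbrev ModelSpace (n : ℕ) : Type := Lp Fib 2 (volume : Measure (Euc n))

/-- The free evolution in similarity variables on the model space. -/
noncomputable def modelEvol {s₁ s₂ : ℝ} (hs : s₁ ≤ s₂) (τ : ℝ≥0) :
    ModelSpace n →L[ℂ] ModelSpace n :=
  LinearMap.mkContinuous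
    { toFun := fun f => (memLp_evolFun hs τ.2 (Lp.memLp f)).1.toLp
      map_add' := fun f g => by
        rw [← MemLp.toLp_add]
        refine MemLp.toLp_congr _ _ ((evolFun_congr_ae (Lp.coeFn_add f g)).trans ?_)
        refine Filter.Eventually.of_forall fun ξ => ?_
        ext k
        simp [mul_add]
      map_smul' := fun c f => by
        rw [RingHom.id_apply, ← MemLp.toLp_const_smul]
        refine MemLp.toLp_congr _ _ ((evolFun_congr_ae (Lp.coeFn_smul c f)).trans ?_)
        refine Filter.Eventually.of_forall fun ξ => ?_
        ext k
        simp [mul_left_comm] }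
    (Real.exp ((n / 2 - 1 - s₁) * τ)) fun f => by
      change ‖(memLp_evolFun hs τ.2 (Lp.memLp f)).1.toLp‖ ≤ _
      rw [Lp.norm_toLp, Lp.norm_def, ← ENNReal.toReal_ofReal (Real.exp_pos _).le,
        ← ENNReal.toReal_mul]
      exact ENNReal.toReal_mono (ENNReal.mul_lt_top (by simp) (Lp.memLp f).2).ne
        (memLp_evolFun hs τ.2 (Lp.memLp f)).2

theorem modelEvol_coeFn {s₁ s₂ : ℝ} (hs : s₁ ≤ s₂) (τ : ℝ≥0) (f : ModelSpace n) :
    modelEvol hs τ f =ᵐ[volume] evolFun s₁ s₂ τ f :=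
  (memLp_evolFun hs τ.2 (Lp.memLp f)).1.coeFn_toLp

theorem norm_modelEvol_le {s₁ s₂ : ℝ} (hs : s₁ ≤ s₂) (τ : ℝ≥0) (f : ModelSpace n) :
    ‖modelEvol hs τ f‖ ≤ Real.exp ((n / 2 - 1 - s₁) * τ) * ‖f‖ := by
  refine (ContinuousLinearMap.le_opNorm _ _).trans ?_
  gcongr
  exact LinearMap.mkContinuous_norm_le _ (Real.exp_pos _).le _

theorem modelEvol_zero {s₁ s₂ : ℝ} (hs : s₁ ≤ s₂) (f : ModelSpace n) : modelEvol hs 0 f = f := by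
  refine Lp.ext ((modelEvol_coeFn hs 0 f).trans (Filter.Eventually.of_forall fun ξ => ?_))
  ext k
  simp [evolMult]

theorem modelEvol_add {s₁ s₂ : ℝ} (hs : s₁ ≤ s₂) (σ τ : ℝ≥0) (f : ModelSpace n) :
    modelEvol hs (σ + τ) f = modelEvol hs σ (modelEvol hs τ f) := by
  refine Lp.ext ?_
  refine (modelEvol_coeFn hs (σ + τ) f).trans (Filter.EventuallyEq.trans ?_
    (((modelEvol_coeFn hs σ _).trans (evolFun_congr_ae (modelEvol_coeFn hs τ f))).symm))
  refine Filter.Eventually.of_forall fun ξ => ?_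
  ext k
  rw [evolFun_apply, evolFun_apply, evolFun_apply, NNReal.coe_add, evolMult_add, Real.exp_add,
    smul_smul, mul_assoc, mul_comm (Real.exp (σ : ℝ))]

end Model

/-! ### Schwartz data in the model space and their time derivative -/

section ModelMap

open MeasureTheory

variable {n : ℕ}

theorem norm_fib_le_sum (x : Fib) : ‖x‖ ≤ ∑ k, ‖x k‖ := by
  refine le_of_sq_le_sq ?_ (by positivity)
  rw [EuclideanSpace.norm_sq_eq]
  exact Finset.sum_sq_le_sq_sum_of_nonneg fun k _ => norm_nonneg _

/-- The diagonalised weighted Fourier variables of a pair of functions. -/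
noncomputable def modelFun (s₁ s₂ : ℝ) (v₁ v₂ : Euc n → ℂ) (ξ : Euc n) : Fib :=
  WithLp.toLp 2 fun k => ((√2)⁻¹ : ℝ) * (((‖ξ‖ ^ modeExp s₁ s₂ k : ℝ) : ℂ) * v₁ ξ -
    Complex.I * (modeSign k : ℝ) * (((‖ξ‖ ^ (modeExp s₁ s₂ k - 1) : ℝ) : ℂ) * v₂ ξ))

@[simp]
theorem modelFun_apply (s₁ s₂ : ℝ) (v₁ v₂ : Euc n → ℂ) (ξ : Euc n) (k : Bool × Bool) :
    modelFun s₁ s₂ v₁ v₂ ξ k =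
      ((√2)⁻¹ : ℝ) * (((‖ξ‖ ^ modeExp s₁ s₂ k : ℝ) : ℂ) * v₁ ξ -
      Complex.I * (modeSign k : ℝ) * (((‖ξ‖ ^ (modeExp s₁ s₂ k - 1) : ℝ) : ℂ) * v₂ ξ)) := rfl

/-- A polynomial order of decay that makes weighted Fourier variables square integrable. -/
noncomputable def decayOrder (n : ℕ) (s₂ : ℝ) : ℕ := ⌈s₂ + (n + 1)⌉₊

/-- The decay order exceeds `s₂ + n + 1`: at most `s₂` powers absorb the weight, and `n + 1` remain
for integrability. -/
theorem weight_mul_le {s s₂ : ℝ} (hs0 : 0 ≤ s) (hs : s ≤ s₂) {B a : ℝ} (hB : 0 ≤ B) {ξ : Euc n}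
    (ha : (1 + ‖ξ‖) ^ decayOrder n s₂ * a ≤ B) :
    ‖ξ‖ ^ s * a ≤ B * (1 + ‖ξ‖) ^ (-((n : ℝ) + 1)) := by
  have hpos : (0 : ℝ) < 1 + ‖ξ‖ := by positivity
  have hN : s₂ + (n + 1) ≤ decayOrder n s₂ := Nat.le_ceil _
  have ha' : a ≤ B * (1 + ‖ξ‖) ^ (-(decayOrder n s₂ : ℝ)) := by
    rw [Real.rpow_neg hpos.le, Real.rpow_natCast, ← div_eq_mul_inv, le_div_iff₀ (by positivity),
      mul_comm]
    exact ha
  calc ‖ξ‖ ^ s * a ≤ (1 + ‖ξ‖) ^ s * (B * (1 + ‖ξ‖) ^ (-(decayOrder n s₂ : ℝ))) := by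
        refine (mul_le_mul_of_nonneg_left ha' (by positivity)).trans ?_
        gcongr
        linarith
    _ = B * (1 + ‖ξ‖) ^ (s - decayOrder n s₂) := by
        rw [sub_eq_add_neg, Real.rpow_add hpos]; ring
    _ ≤ _ := by
        gcongr
        · linarith [norm_nonneg ξ]
        · linarith

theorem norm_modelFun_le {s₁ s₂ : ℝ} (h1 : 1 < s₁) (hs : s₁ ≤ s₂) {v₁ v₂ : Euc n → ℂ} {B : ℝ}
    (hB : 0 ≤ B) {ξ : Euc n} (hv₁ : (1 + ‖ξ‖) ^ decayOrder n s₂ * ‖v₁ ξ‖ ≤ B)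
    (hv₂ : (1 + ‖ξ‖) ^ decayOrder n s₂ * ‖v₂ ξ‖ ≤ B) :
    ‖modelFun s₁ s₂ v₁ v₂ ξ‖ ≤ 8 * B * (1 + ‖ξ‖) ^ (-((n : ℝ) + 1)) := by
  refine (norm_fib_le_sum _).trans ?_
  -- Two terms in each of four modes make the constant `8`; the factor `1/√2` is discarded.
  have key : ∀ k, ‖modelFun s₁ s₂ v₁ v₂ ξ k‖ ≤ 2 * (B * (1 + ‖ξ‖) ^ (-((n : ℝ) + 1))) := by
    intro k
    have e1 := le_modeExp hs k
    have e2 := modeExp_le hs k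
    have w1 := weight_mul_le (s := modeExp s₁ s₂ k) (by linarith) e2 hB hv₁
    have w2 := weight_mul_le (s := modeExp s₁ s₂ k - 1) (by linarith) (by linarith) hB hv₂
    have hsq : (√2)⁻¹ ≤ 1 := inv_le_one_of_one_le₀ (Real.one_le_sqrt.mpr (by norm_num))
    have hsgn : ‖((modeSign k : ℝ) : ℂ)‖ = 1 := by
      rw [Complex.norm_real, modeSign]
      split_ifs <;> simp
    rw [modelFun_apply, norm_mul, Complex.norm_real, Real.norm_of_nonneg (by positivity)]
    refine (mul_le_of_le_one_left (norm_nonneg _) hsq).trans ((norm_sub_le _ _).trans ?_)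
    rw [norm_mul, norm_mul, norm_mul, norm_mul, Complex.norm_I, hsgn, Complex.norm_real,
      Complex.norm_real, Real.norm_of_nonneg (by positivity), Real.norm_of_nonneg (by positivity)]
    linarith
  refine (Finset.sum_le_sum fun k _ => key k).trans_eq ?_
  simp
  ring

theorem memLp_one_add_norm :
    MemLp (fun ξ : Euc n => (1 + ‖ξ‖) ^ (-((n : ℝ) + 1))) 2 := by
  have hm : Continuous (fun ξ : Euc n => (1 + ‖ξ‖) ^ (-((n : ℝ) + 1))) := by
    refine Continuous.rpow_const (by fun_prop) fun ξ => Or.inl ?_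
    positivity
  rw [memLp_two_iff_integrable_sq_norm hm.aestronglyMeasurable]
  have : Integrable (fun ξ : Euc n => (1 + ‖ξ‖) ^ (-(2 * ((n : ℝ) + 1)))) := by
    refine integrable_one_add_norm ?_
    simp
    linarith
  refine this.congr (Filter.Eventually.of_forall fun ξ => ?_)
  have hpos : (0 : ℝ) < 1 + ‖ξ‖ := by positivity
  simp only [Real.norm_eq_abs, sq_abs]
  rw [← Real.rpow_natCast, ← Real.rpow_mul hpos.le]
  congr 1
  push_cast
  ring

theorem aestronglyMeasurable_modelFun (s₁ s₂ : ℝ) {v₁ v₂ : Euc n → ℂ} (hv₁ : Continuous v₁)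
    (hv₂ : Continuous v₂) : AEStronglyMeasurable (modelFun s₁ s₂ v₁ v₂) volume := by
  refine (PiLp.continuous_toLp 2 _).comp_aestronglyMeasurable ?_
  refine (measurable_pi_iff.mpr fun k => ?_).aestronglyMeasurable
  have := hv₁.measurable
  have := hv₂.measurable
  fun_prop

open SchwartzMap

/-- The seminorm controlling weighted Fourier variables. -/
noncomputable def decaySeminorm (n : ℕ) (s₂ : ℝ) : Seminorm ℂ 𝓢(Euc n, ℂ) :=
  (Finset.Iic (decayOrder n s₂, 0)).sup (schwartzSeminormFamily ℂ (Euc n) ℂ)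

theorem decay_le (s₂ : ℝ) (f : 𝓢(Euc n, ℂ)) (ξ : Euc n) :
    (1 + ‖ξ‖) ^ decayOrder n s₂ * ‖f ξ‖ ≤ 2 ^ decayOrder n s₂ * decaySeminorm n s₂ f := by
  have := SchwartzMap.one_add_le_sup_seminorm_apply (𝕜 := ℂ) (m := (decayOrder n s₂, 0))
    (k := decayOrder n s₂) (n := 0) le_rfl le_rfl f ξ
  rw [norm_iteratedFDeriv_zero] at this
  exact this

theorem decay_le_add (s₂ : ℝ) (v₁ v₂ : 𝓢(Euc n, ℂ)) (ξ : Euc n) :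
    (1 + ‖ξ‖) ^ decayOrder n s₂ * ‖v₁ ξ‖ ≤
      2 ^ decayOrder n s₂ * (decaySeminorm n s₂ v₁ + decaySeminorm n s₂ v₂) ∧
    (1 + ‖ξ‖) ^ decayOrder n s₂ * ‖v₂ ξ‖ ≤
      2 ^ decayOrder n s₂ * (decaySeminorm n s₂ v₁ + decaySeminorm n s₂ v₂) := by
  have p1 := apply_nonneg (decaySeminorm n s₂) v₁
  have p2 := apply_nonneg (decaySeminorm n s₂) v₂
  refine ⟨(decay_le s₂ v₁ ξ).trans ?_, (decay_le s₂ v₂ ξ).trans ?_⟩ <;> gcongr <;> linarith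

theorem norm_modelFun_schwartz_le {s₁ s₂ : ℝ} (h1 : 1 < s₁) (hs : s₁ ≤ s₂) (v₁ v₂ : 𝓢(Euc n, ℂ))
    (ξ : Euc n) : ‖modelFun s₁ s₂ v₁ v₂ ξ‖ ≤
      8 * (2 ^ decayOrder n s₂ * (decaySeminorm n s₂ v₁ + decaySeminorm n s₂ v₂)) *
        (1 + ‖ξ‖) ^ (-((n : ℝ) + 1)) :=
  norm_modelFun_le h1 hs (by positivity) (decay_le_add s₂ v₁ v₂ ξ).1 (decay_le_add s₂ v₁ v₂ ξ).2

theorem memLp_modelFun {s₁ s₂ : ℝ} (h1 : 1 < s₁) (hs : s₁ ≤ s₂) (v₁ v₂ : 𝓢(Euc n, ℂ)) :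
    MemLp (modelFun s₁ s₂ v₁ v₂) 2 := by
  refine (memLp_one_add_norm.const_mul (8 * (2 ^ decayOrder n s₂ *
    (decaySeminorm n s₂ v₁ + decaySeminorm n s₂ v₂)))).mono'
    (aestronglyMeasurable_modelFun s₁ s₂ v₁.continuous v₂.continuous)
    (Filter.Eventually.of_forall fun ξ => ?_)
  exact norm_modelFun_schwartz_le h1 hs v₁ v₂ ξ

theorem norm_toLp_modelFun_le {s₁ s₂ : ℝ} (h1 : 1 < s₁) (hs : s₁ ≤ s₂) (v₁ v₂ : 𝓢(Euc n, ℂ)) :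
    ‖(memLp_modelFun h1 hs v₁ v₂).toLp‖ ≤
      8 * (2 ^ decayOrder n s₂ * (decaySeminorm n s₂ v₁ + decaySeminorm n s₂ v₂)) *
        ‖(memLp_one_add_norm (n := n)).toLp‖ := by
  refine Lp.norm_le_mul_norm_of_ae_le_mul ?_
  filter_upwards [(memLp_modelFun h1 hs v₁ v₂).coeFn_toLp,
    (memLp_one_add_norm (n := n)).coeFn_toLp] with ξ e1 e2
  rw [e1, e2, Real.norm_of_nonneg (by positivity)]
  exact norm_modelFun_schwartz_le h1 hs v₁ v₂ ξ

/-- The continuous embedding of pairs of Schwartz functions (on the Fourier side) into the model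
space. -/
noncomputable def modelMap {s₁ s₂ : ℝ} (h1 : 1 < s₁) (hs : s₁ ≤ s₂) :
    𝓢(Euc n, ℂ) × 𝓢(Euc n, ℂ) →L[ℂ] ModelSpace n :=
  (mkCLMtoNormedSpace (σ := RingHom.id ℂ) (fun v => (memLp_modelFun h1 hs v 0).toLp)
    (fun f g => by
      rw [← MemLp.toLp_add]
      refine MemLp.toLp_congr _ _ (Filter.Eventually.of_forall fun ξ => ?_)
      ext k
      simp
      ring)
    (fun c f => by
      rw [RingHom.id_apply, ← MemLp.toLp_const_smul]
      refine MemLp.toLp_congr _ _ (Filter.Eventually.of_forall fun ξ => ?_)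
      ext k
      simp
      ring)
    ⟨Finset.Iic (decayOrder n s₂, 0), 8 * 2 ^ decayOrder n s₂ *
      ‖(memLp_one_add_norm (n := n)).toLp‖, by positivity, fun f => by
      refine (norm_toLp_modelFun_le h1 hs f 0).trans_eq ?_
      rw [map_zero, decaySeminorm]
      ring⟩).coprod
  (mkCLMtoNormedSpace (σ := RingHom.id ℂ) (fun v => (memLp_modelFun h1 hs 0 v).toLp)
    (fun f g => by
      rw [← MemLp.toLp_add]
      refine MemLp.toLp_congr _ _ (Filter.Eventually.of_forall fun ξ => ?_)
      ext k
      simp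
      ring)
    (fun c f => by
      rw [RingHom.id_apply, ← MemLp.toLp_const_smul]
      refine MemLp.toLp_congr _ _ (Filter.Eventually.of_forall fun ξ => ?_)
      ext k
      simp
      ring)
    ⟨Finset.Iic (decayOrder n s₂, 0), 8 * 2 ^ decayOrder n s₂ *
      ‖(memLp_one_add_norm (n := n)).toLp‖, by positivity, fun f => by
      refine (norm_toLp_modelFun_le h1 hs 0 f).trans_eq ?_
      rw [map_zero, decaySeminorm]
      ring⟩)

theorem modelMap_coeFn {s₁ s₂ : ℝ} (h1 : 1 < s₁) (hs : s₁ ≤ s₂)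
    (v : 𝓢(Euc n, ℂ) × 𝓢(Euc n, ℂ)) :
    modelMap h1 hs v =ᵐ[volume] modelFun s₁ s₂ v.1 v.2 := by
  have e : modelMap h1 hs v =
      (memLp_modelFun h1 hs v.1 0).toLp + (memLp_modelFun h1 hs 0 v.2).toLp := rfl
  rw [e]
  filter_upwards [Lp.coeFn_add (memLp_modelFun h1 hs v.1 0).toLp
    (memLp_modelFun h1 hs 0 v.2).toLp, (memLp_modelFun h1 hs v.1 0).coeFn_toLp,
    (memLp_modelFun h1 hs 0 v.2).coeFn_toLp] with ξ e1 e2 e3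
  rw [e1, Pi.add_apply, e2, e3]
  ext k
  simp
  ring

theorem norm_dilation_rpow (τ s : ℝ) (ξ : Euc n) :
    ‖Real.exp τ • ξ‖ ^ s = Real.exp (s * τ) * ‖ξ‖ ^ s := by
  rw [norm_smul, Real.norm_eq_abs, Real.abs_exp, Real.mul_rpow (Real.exp_pos τ).le (norm_nonneg ξ),
    ← Real.exp_mul, mul_comm τ]

theorem hasDerivAt_comp_dilation (v : 𝓢(Euc n, ℂ)) (ξ : Euc n) (τ : ℝ) :
    HasDerivAt (fun τ : ℝ => v (Real.exp τ • ξ))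
      (fderiv ℝ v (Real.exp τ • ξ) (Real.exp τ • ξ)) τ := by
  have hl : HasDerivAt (fun τ : ℝ => Real.exp τ • ξ) (Real.exp τ • ξ) τ :=
    (Real.hasDerivAt_exp τ).smul_const ξ
  exact (v.hasFDerivAt (Real.exp τ • ξ)).comp_hasDerivAt τ hl

/-- Pointwise differential equation of the free evolution. -/
theorem hasDerivAt_evolFun {s₁ s₂ : ℝ} (h1 : 1 < s₁) (hs : s₁ ≤ s₂) {v₁ v₂ w₁ w₂ : 𝓢(Euc n, ℂ)}
    (hw₁ : ∀ ξ, w₁ ξ = fderiv ℝ v₁ ξ ξ + (n - 1) * v₁ ξ + v₂ ξ)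
    (hw₂ : ∀ ξ, w₂ ξ = -((‖ξ‖ ^ 2 : ℝ) : ℂ) * v₁ ξ + fderiv ℝ v₂ ξ ξ + (n - 2) * v₂ ξ)
    (ξ : Euc n) (τ : ℝ) :
    HasDerivAt (fun τ => evolFun s₁ s₂ τ (modelFun s₁ s₂ v₁ v₂) ξ)
      (evolFun s₁ s₂ τ (modelFun s₁ s₂ w₁ w₂) ξ) τ := by
  have hpi : HasDerivAt (fun τ k => evolMult s₁ s₂ τ ξ k *
        modelFun s₁ s₂ v₁ v₂ (Real.exp τ • ξ) k)
      (fun k => evolMult s₁ s₂ τ ξ k * modelFun s₁ s₂ w₁ w₂ (Real.exp τ • ξ) k) τ := by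
    refine hasDerivAt_pi.mpr fun k => ?_
    have hsk : 1 < modeExp s₁ s₂ k := h1.trans_le (le_modeExp hs k)
    set s := modeExp s₁ s₂ k with hsdef
    have hexp : ∀ a : ℝ, HasDerivAt (fun τ : ℝ => ((Real.exp (a * τ) : ℝ) : ℂ))
        (a * ((Real.exp (a * τ) : ℝ) : ℂ)) τ := by
      intro a
      have := ((hasDerivAt_id τ).const_mul a).exp.ofReal_comp
      simpa [mul_comm] using this
    have hmult : HasDerivAt (fun τ => evolMult s₁ s₂ τ ξ k)
        (evolMult s₁ s₂ τ ξ k * (((n - 1 - s : ℝ) : ℂ) +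
          ((modeSign k * (Real.exp τ * ‖ξ‖) : ℝ) : ℂ) * Complex.I)) τ := by
      unfold evolMult
      refine HasDerivAt.cexp ?_
      refine HasDerivAt.add ?_ (HasDerivAt.mul_const ?_ _)
      · have := ((hasDerivAt_id τ).const_mul (n - 1 - s : ℝ)).ofReal_comp
        simpa using this
      · exact ((((Real.hasDerivAt_exp τ).sub_const 1).mul_const ‖ξ‖).const_mul
          (modeSign k)).ofReal_comp
    simp only [modelFun_apply, norm_dilation_rpow, hw₁, hw₂, ← hsdef]
    have hV₁ := ((hexp s).mul_const ((‖ξ‖ ^ s : ℝ) : ℂ)).mul (hasDerivAt_comp_dilation v₁ ξ τ)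
    have hV₂ := ((hexp (s - 1)).mul_const ((‖ξ‖ ^ (s - 1) : ℝ) : ℂ)).mul
      (hasDerivAt_comp_dilation v₂ ξ τ)
    have hd := hmult.mul ((hV₁.sub (hV₂.const_mul
      (Complex.I * (modeSign k : ℝ)))).const_mul ((((√2)⁻¹ : ℝ) : ℂ)))
    have hnorm : ‖Real.exp τ • ξ‖ = Real.exp τ * ‖ξ‖ := by
      rw [norm_smul, Real.norm_eq_abs, Real.abs_exp]
    -- Valid also at `ξ = 0`, because `s ≠ 0`.
    have hR : ‖ξ‖ ^ s = ‖ξ‖ * ‖ξ‖ ^ (s - 1) := by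
      conv_rhs => rw [← Real.rpow_one_add' (norm_nonneg ξ) (by linarith)]
      congr 1
      ring
    have hA : Real.exp (s * τ) = Real.exp τ * Real.exp ((s - 1) * τ) := by
      rw [← Real.exp_add]
      congr 1
      ring
    have hI : Complex.I * Complex.I = -1 := Complex.I_mul_I
    have hσ : (modeSign k : ℂ) * (modeSign k : ℂ) = 1 := by exact_mod_cast modeSign_sq k
    refine (hd.congr_deriv ?_).congr_of_eventuallyEq (Filter.Eventually.of_forall fun τ => ?_)
    · simp only [Pi.mul_apply, Pi.sub_apply]
      rw [hnorm, hR, hA]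
      simp only [Complex.ofReal_mul, Complex.ofReal_sub, Complex.ofReal_pow, Complex.ofReal_natCast,
        Complex.ofReal_one]
      generalize fderiv ℝ v₁ (Real.exp τ • ξ) (Real.exp τ • ξ) = dV₁
      generalize fderiv ℝ v₂ (Real.exp τ • ξ) (Real.exp τ • ξ) = dV₂
      generalize v₁ (Real.exp τ • ξ) = V₁
      generalize v₂ (Real.exp τ • ξ) = V₂
      generalize ((‖ξ‖ ^ (s - 1) : ℝ) : ℂ) = ρ
      -- Only the `V₂` coupling needs `i² = -1` and `σ² = 1`: the phase derivative `iσ|ξ|` times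
      -- `-iσ|ξ|^(s-1) V₂` is `|ξ|^s V₂`, the source term in `w₁`.
      linear_combination (-(evolMult s₁ s₂ τ ξ k * ((√2)⁻¹ : ℝ) * Real.exp τ * ‖ξ‖ *
        Real.exp ((s - 1) * τ) * ρ * V₂) * (modeSign k : ℂ) ^ 2) * hI +
        (evolMult s₁ s₂ τ ξ k * ((√2)⁻¹ : ℝ) * Real.exp τ * ‖ξ‖ *
        Real.exp ((s - 1) * τ) * ρ * V₂) * hσ
    · simp only [Pi.mul_apply, Pi.sub_apply, Complex.ofReal_mul]
  exact (PiLp.continuousLinearEquiv 2 ℝ (fun _ : Bool × Bool => ℂ)).symm.hasFDerivAt.comp_hasDerivAt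
    τ hpi

/-- For `0 ≤ τ ≤ 1` the dilation pushes `ξ` outward, which only improves the decay. The bound serves
as dominating function for the difference quotients. -/
theorem norm_evolFun_modelFun_le {s₁ s₂ : ℝ} (h1 : 1 < s₁) (hs : s₁ ≤ s₂)
    (w₁ w₂ : 𝓢(Euc n, ℂ)) : ∃ C : ℝ, ∀ τ : ℝ, 0 ≤ τ → τ ≤ 1 → ∀ ξ,
    ‖evolFun s₁ s₂ τ (modelFun s₁ s₂ w₁ w₂) ξ‖ ≤ C * (1 + ‖ξ‖) ^ (-((n : ℝ) + 1)) := by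
  refine ⟨Real.exp |(n : ℝ) - 1 - s₁| * (8 * (2 ^ decayOrder n s₂ *
    (decaySeminorm n s₂ w₁ + decaySeminorm n s₂ w₂))), fun τ h0 h1' ξ => ?_⟩
  refine (norm_evolFun_le hs h0 _ ξ).trans ?_
  rw [mul_assoc]
  have e1 : (n - 1 - s₁) * τ ≤ |(n : ℝ) - 1 - s₁| := by
    calc (n - 1 - s₁) * τ ≤ |(n : ℝ) - 1 - s₁| * 1 := by
          gcongr
          exact le_abs_self _
      _ = _ := mul_one _
  gcongr
  refine (norm_modelFun_schwartz_le h1 hs w₁ w₂ _).trans ?_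
  gcongr 8 * (2 ^ _ * (_ + _)) * ?_
  refine Real.rpow_le_rpow_of_nonpos (by positivity) ?_ (by linarith)
  rw [norm_smul, Real.norm_eq_abs, Real.abs_exp]
  gcongr
  exact le_mul_of_one_le_left (norm_nonneg _) (Real.one_le_exp h0)

/-- Pairs of Schwartz functions lie in the domain of the generator of the free evolution. -/
theorem tendsto_quotient_modelMap {s₁ s₂ : ℝ} (h1 : 1 < s₁) (hs : s₁ ≤ s₂)
    {v w : 𝓢(Euc n, ℂ) × 𝓢(Euc n, ℂ)}
    (hw₁ : ∀ ξ, w.1 ξ = fderiv ℝ v.1 ξ ξ + (n - 1) * v.1 ξ + v.2 ξ)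
    (hw₂ : ∀ ξ, w.2 ξ = -((‖ξ‖ ^ 2 : ℝ) : ℂ) * v.1 ξ + fderiv ℝ v.2 ξ ξ + (n - 2) * v.2 ξ) :
    Filter.Tendsto (fun τ : ℝ≥0 => (((τ : ℝ) : ℂ)⁻¹) •
      (modelEvol hs τ (modelMap h1 hs v) - modelMap h1 hs v)) (𝓝[>] 0)
      (𝓝 (modelMap h1 hs w)) := by
  obtain ⟨C, hC⟩ := norm_evolFun_modelFun_le h1 hs w.1 w.2
  have hd := hasDerivAt_evolFun h1 hs hw₁ hw₂
  have hzero : ∀ u₁ u₂ : Euc n → ℂ, ∀ ξ,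
      evolFun s₁ s₂ 0 (modelFun s₁ s₂ u₁ u₂) ξ = modelFun s₁ s₂ u₁ u₂ ξ := by
    intro u₁ u₂ ξ
    ext k
    simp [evolMult]
  refine tendsto_Lp_two_of_dominated
    (F := fun (τ : ℝ≥0) ξ => (((τ : ℝ) : ℂ)⁻¹) • (evolFun s₁ s₂ τ (modelFun s₁ s₂ v.1 v.2) ξ -
      modelFun s₁ s₂ v.1 v.2 ξ))
    -- One `C` bounds the difference quotient, by the mean value inequality; the other bounds the
    -- limit.
    (fun τ => ?_) (memLp_one_add_norm.const_mul (C + C)) ?_ ?_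
  · filter_upwards [Lp.coeFn_smul (((τ : ℝ) : ℂ)⁻¹)
      (modelEvol hs τ (modelMap h1 hs v) - modelMap h1 hs v),
      Lp.coeFn_sub (modelEvol hs τ (modelMap h1 hs v)) (modelMap h1 hs v),
      modelMap_coeFn h1 hs v, (modelEvol_coeFn hs τ (modelMap h1 hs v)).trans
        (evolFun_congr_ae (modelMap_coeFn h1 hs v))] with ξ e1 e2 e3 e4
    rw [e1, Pi.smul_apply, e2, Pi.sub_apply, e3, e4]
  · have hsmall : ∀ᶠ τ : ℝ≥0 in 𝓝[>] 0, τ ≤ 1 :=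
      nhdsWithin_le_nhds (Iic_mem_nhds (by norm_num))
    filter_upwards [hsmall, self_mem_nhdsWithin] with τ hτ1 hτ0
    have hτ0' : (0 : ℝ) < τ := hτ0
    filter_upwards [modelMap_coeFn h1 hs w] with ξ hξ
    rw [hξ, add_mul]
    refine (norm_sub_le _ _).trans (add_le_add ?_ ?_)
    · have := norm_image_sub_le_of_norm_deriv_le_segment' (a := (0 : ℝ)) (b := τ)
        (f := fun τ => evolFun s₁ s₂ τ (modelFun s₁ s₂ v.1 v.2) ξ)
        (f' := fun τ => evolFun s₁ s₂ τ (modelFun s₁ s₂ w.1 w.2) ξ)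
        (C := C * (1 + ‖ξ‖) ^ (-((n : ℝ) + 1)))
        (fun r _ => (hd ξ r).hasDerivWithinAt)
        (fun r hr => hC r hr.1 (hr.2.le.trans hτ1) ξ) τ (Set.right_mem_Icc.mpr hτ0'.le)
      rw [hzero, sub_zero] at this
      rw [norm_smul, norm_inv, Complex.norm_real, Real.norm_of_nonneg hτ0'.le,
        inv_mul_le_iff₀ hτ0', mul_comm (τ : ℝ)]
      exact this
    · have := hC 0 le_rfl zero_le_one ξ
      rwa [hzero] at this
  · filter_upwards [modelMap_coeFn h1 hs w] with ξ hξ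
    rw [hξ]
    have := hd ξ 0
    rw [hasDerivAt_iff_tendsto_slope, hzero] at this
    refine (this.comp (tendsto_coe_nnreal_punctured.mono_right
      (nhdsWithin_mono _ (fun r (hr : 0 < r) => hr.ne')))).congr fun τ => ?_
    simp only [Function.comp_apply, slope_def_module, hzero, sub_zero]
    rw [← Complex.ofReal_inv, Complex.coe_smul]

end ModelMap

/-! ### Fourier symbols of `Λ` and `Δ`, and radial symmetry -/

section Schwartz

open MeasureTheory SchwartzMap LineDeriv

variable {n : ℕ}

/-- `Λ f (x) = x · ∇ f (x)` on Schwartz functions. -/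
noncomputable def eulerSchwartz (n : ℕ) : 𝓢(Euc n, ℂ) →L[ℝ] 𝓢(Euc n, ℂ) :=
  bilinLeftCLM (ContinuousLinearMap.id ℝ (Euc n →L[ℝ] ℂ)) Function.HasTemperateGrowth.id ∘L
    fderivCLM ℝ (Euc n) ℂ

@[simp]
theorem eulerSchwartz_apply (f : 𝓢(Euc n, ℂ)) (x : Euc n) :
    eulerSchwartz n f x = fderiv ℝ f x x := rfl

/-- Expansion of `x` in an orthonormal basis, so that the one-directional Fourier rules apply. -/
theorem eulerSchwartz_eq_sum (f : 𝓢(Euc n, ℂ)) :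
    eulerSchwartz n f = ∑ i, smulLeftCLM ℂ (inner ℝ · (EuclideanSpace.basisFun (Fin n) ℝ i))
      (∂_{EuclideanSpace.basisFun (Fin n) ℝ i} f) := by
  ext x
  rw [eulerSchwartz_apply, sum_apply]
  have hx : x = ∑ i, inner ℝ x (EuclideanSpace.basisFun (Fin n) ℝ i) •
      EuclideanSpace.basisFun (Fin n) ℝ i := by
    conv_lhs => rw [← (EuclideanSpace.basisFun (Fin n) ℝ).sum_repr' x]
    simp only [real_inner_comm]
  conv_lhs => rw [show fderiv ℝ f x x = fderiv ℝ f x (∑ i, inner ℝ x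
    (EuclideanSpace.basisFun (Fin n) ℝ i) • EuclideanSpace.basisFun (Fin n) ℝ i) from
    congrArg _ hx]
  rw [map_sum]
  refine Finset.sum_congr rfl fun i _ => ?_
  rw [smulLeftCLM_apply_apply (by fun_prop), map_smul, lineDerivOp_apply_eq_fderiv]

/-- The transform of `∂_m f` is `2πi⟨ξ, m⟩ 𝓕f`, and multiplying by `⟨x, m⟩` differentiates it along
`m`; the product rule gives both terms, and `‖m‖²` is the derivative of `⟨ξ, m⟩`. -/
theorem fourier_smul_lineDerivOp (f : 𝓢(Euc n, ℂ)) (m : Euc n) (ξ : Euc n) :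
    𝓕 (smulLeftCLM ℂ (inner ℝ · m) (∂_{m} f)) ξ =
      -((‖m‖ ^ 2 : ℝ) • 𝓕 f ξ + inner ℝ ξ m • fderiv ℝ (𝓕 f : 𝓢(Euc n, ℂ)) ξ m) := by
  have hm : (inner ℝ · m : Euc n → ℝ).HasTemperateGrowth := by fun_prop
  have h1 := lineDerivOp_fourier_eq (∂_{m} f) m
  rw [fourier_lineDerivOp_eq, FourierTransform.fourier_smul] at h1
  have h2 := congrArg (fun g : 𝓢(Euc n, ℂ) => g ξ) h1
  simp only [smul_apply, lineDerivOp_apply_eq_fderiv] at h2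
  have h3 : ((2 * Real.pi * Complex.I) • smulLeftCLM ℂ (inner ℝ · m) (𝓕 f) : 𝓢(Euc n, ℂ)) =
      fun x => (2 * Real.pi * Complex.I) • (inner ℝ x m • 𝓕 f x) := by
    funext x
    rw [smul_apply, smulLeftCLM_apply_apply hm]
  have h4 : HasFDerivAt (fun x => (2 * Real.pi * Complex.I) • (inner ℝ x m • 𝓕 f x))
      ((2 * Real.pi * Complex.I) • (inner ℝ ξ m • fderiv ℝ (𝓕 f : 𝓢(Euc n, ℂ)) ξ +
        ((innerSL ℝ).flip m).smulRight (𝓕 f ξ))) ξ := by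
    have := ((innerSL ℝ).flip m).hasFDerivAt (x := ξ)
    have h := (this.smul ((𝓕 f : 𝓢(Euc n, ℂ)).hasFDerivAt ξ)).const_smul
      (2 * Real.pi * Complex.I)
    exact h
  rw [h3, h4.fderiv] at h2
  have hc : (2 * Real.pi * Complex.I) ≠ 0 := Complex.two_pi_I_ne_zero
  have h5 : inner ℝ ξ m • fderiv ℝ (𝓕 f : 𝓢(Euc n, ℂ)) ξ m + (‖m‖ ^ 2 : ℝ) • 𝓕 f ξ =
      -𝓕 (smulLeftCLM ℂ (inner ℝ · m) (∂_{m} f)) ξ := by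
    refine smul_right_injective ℂ hc ?_
    simp only
    rw [smul_neg, ← neg_smul, ← h2]
    have hmm : innerSL ℝ m m = ‖m‖ ^ 2 := by
      rw [innerSL_apply_apply, real_inner_self_eq_norm_sq]
    simp [hmm, mul_add]
  rw [add_comm, h5, neg_neg]

/-- The zeroth-order coefficient `n` is the sum of `‖e_i‖² = 1` over the basis. -/
theorem fourier_eulerSchwartz (f : 𝓢(Euc n, ℂ)) (ξ : Euc n) :
    𝓕 (eulerSchwartz n f) ξ = -((n : ℂ) * 𝓕 f ξ + fderiv ℝ (𝓕 f : 𝓢(Euc n, ℂ)) ξ ξ) := by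
  rw [eulerSchwartz_eq_sum]
  have h1 : 𝓕 (∑ i, smulLeftCLM ℂ (inner ℝ · (EuclideanSpace.basisFun (Fin n) ℝ i))
      (∂_{EuclideanSpace.basisFun (Fin n) ℝ i} f)) =
      ∑ i, 𝓕 (smulLeftCLM ℂ (inner ℝ · (EuclideanSpace.basisFun (Fin n) ℝ i))
      (∂_{EuclideanSpace.basisFun (Fin n) ℝ i} f)) := by
    simp only [← fourierTransformCLM_apply ℂ, map_sum]
  rw [h1, sum_apply]
  simp only [fourier_smul_lineDerivOp]
  have h2 := congrArg (fun g : 𝓢(Euc n, ℂ) => g ξ) (eulerSchwartz_eq_sum (𝓕 f))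
  simp only [sum_apply, eulerSchwartz_apply] at h2
  rw [h2, Finset.sum_neg_distrib, Finset.sum_add_distrib]
  congr 2
  · simp
  · refine Finset.sum_congr rfl fun i _ => ?_
    rw [smulLeftCLM_apply_apply (by fun_prop), lineDerivOp_apply_eq_fderiv]

theorem fourier_laplacian (f : 𝓢(Euc n, ℂ)) (ξ : Euc n) :
    𝓕 (Laplacian.laplacian f) ξ = -((((2 * Real.pi) ^ 2 * ‖ξ‖ ^ 2 : ℝ) : ℂ) * 𝓕 f ξ) := by
  have hg : (fun x : Euc n => ‖x‖ ^ 2).HasTemperateGrowth := by fun_prop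
  have h1 : Laplacian.laplacian f =
      𝓕⁻ ((-((2 * Real.pi) ^ 2 : ℝ) : ℂ) • smulLeftCLM ℂ (fun x : Euc n => ‖x‖ ^ 2) (𝓕 f)) := by
    rw [FourierTransform.fourierInv_smul, laplacian_eq_fourierMultiplierCLM,
      fourierMultiplierCLM_apply]
    ext x
    simp
  rw [h1, FourierTransform.fourier_fourierInv_eq, smul_apply, smulLeftCLM_apply_apply hg]
  simp
  ring

/-- The dilation by `(2π)⁻¹`. -/
noncomputable def fourierScaling (n : ℕ) : Euc n ≃L[ℝ] Euc n :=
  ContinuousLinearEquiv.smulLeft (Units.mk0 (2 * Real.pi)⁻¹ (by positivity))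

theorem fourierScaling_apply (ξ : Euc n) : fourierScaling n ξ = (2 * Real.pi)⁻¹ • ξ := rfl

/-- The normalising constant of the Fourier transform. -/
noncomputable def fourierConst (n : ℕ) : ℂ := (((2 * Real.pi) ^ (-(n : ℝ) / 2) : ℝ) : ℂ)

theorem fourierConst_ne_zero : fourierConst n ≠ 0 := by
  simp only [fourierConst, ne_eq, Complex.ofReal_eq_zero]
  positivity

/-- The Fourier transform with the normalisation of `fourierT` on Schwartz functions. -/
noncomputable def fourierSchwartz (n : ℕ) : 𝓢(Euc n, ℂ) →L[ℂ] 𝓢(Euc n, ℂ) :=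
  fourierConst n • (compCLMOfContinuousLinearEquiv ℂ (fourierScaling n) ∘L
    fourierTransformCLM ℂ)

theorem fourierSchwartz_apply (f : 𝓢(Euc n, ℂ)) (ξ : Euc n) :
    fourierSchwartz n f ξ = fourierConst n * 𝓕 f ((2 * Real.pi)⁻¹ • ξ) := rfl

theorem fourierSchwartz_eq_fourierT (f : 𝓢(Euc n, ℂ)) (ξ : Euc n) :
    fourierSchwartz n f ξ = fourierT f ξ := by
  rw [fourierSchwartz_apply, SchwartzMap.fourier_coe, Real.fourier_eq', fourierT, fourierConst]
  congr 1
  refine integral_congr_ae (Filter.Eventually.of_forall fun x => ?_)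
  have : -2 * Real.pi * inner ℝ x ((2 * Real.pi)⁻¹ • ξ) = - inner ℝ ξ x := by
    rw [inner_smul_right, real_inner_comm]
    field_simp
  simp only [this, smul_eq_mul]
  rw [mul_comm]
  congr 2
  push_cast
  ring

theorem fourierSchwartz_eulerSchwartz (f : 𝓢(Euc n, ℂ)) (ξ : Euc n) :
    fourierSchwartz n (eulerSchwartz n f) ξ =
      -((n : ℂ) * fourierSchwartz n f ξ + fderiv ℝ (fourierSchwartz n f) ξ ξ) := by
  have hd : HasFDerivAt (fourierSchwartz n f) (fourierConst n •
      (fderiv ℝ (𝓕 f : 𝓢(Euc n, ℂ)) ((2 * Real.pi)⁻¹ • ξ)).comp ((fourierScaling n : Euc n →L[ℝ] Euc n))) ξ := by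
    have h1 : HasFDerivAt (𝓕 f : 𝓢(Euc n, ℂ)) (fderiv ℝ (𝓕 f : 𝓢(Euc n, ℂ)) ((2 * Real.pi)⁻¹ • ξ)) (fourierScaling n ξ) :=
      (𝓕 f : 𝓢(Euc n, ℂ)).hasFDerivAt _
    exact (h1.comp ξ (fourierScaling n).hasFDerivAt).const_smul (fourierConst n)
  rw [hd.fderiv, fourierSchwartz_apply, fourierSchwartz_apply, fourier_eulerSchwartz]
  change _ = -(_ + fourierConst n * (fderiv ℝ (𝓕 f : 𝓢(Euc n, ℂ)) ((2 * Real.pi)⁻¹ • ξ)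
    ((2 * Real.pi)⁻¹ • ξ)))
  ring

theorem fourierSchwartz_laplacian (f : 𝓢(Euc n, ℂ)) (ξ : Euc n) :
    fourierSchwartz n (Laplacian.laplacian f) ξ =
      -((‖ξ‖ ^ 2 : ℝ) : ℂ) * fourierSchwartz n f ξ := by
  rw [fourierSchwartz_apply, fourierSchwartz_apply, fourier_laplacian, norm_smul, norm_inv,
    Real.norm_of_nonneg (by positivity)]
  have : (2 * Real.pi) ^ 2 * ((2 * Real.pi)⁻¹ * ‖ξ‖) ^ 2 = ‖ξ‖ ^ 2 := by
    field_simp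
  rw [this]
  ring

/-- Functions depending only on the norm. -/
def IsRadial (f : Euc n → ℂ) : Prop := ∀ x y, ‖x‖ = ‖y‖ → f x = f y

/-- Two vectors of equal norm are exchanged by a reflection. Radiality can thus be checked through
isometries, with which the Fourier transform commutes. -/
theorem IsRadial.of_comp_isometry {f : Euc n → ℂ}
    (h : ∀ A : Euc n ≃ₗᵢ[ℝ] Euc n, f ∘ A = f) : IsRadial f := by
  intro x y hxy
  have := congrFun (h (Submodule.span ℝ {x - y})ᗮ.reflection) x
  rw [Function.comp_apply, Submodule.reflection_sub hxy] at this
  exact this.symm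

theorem IsRadial.comp_isometry {f : Euc n → ℂ} (h : IsRadial f) (A : Euc n ≃ₗᵢ[ℝ] Euc n) :
    f ∘ A = f := funext fun x => h _ _ (A.norm_map x)

theorem IsRadial.fourierSchwartz {f : 𝓢(Euc n, ℂ)} (h : IsRadial f) :
    IsRadial (fourierSchwartz n f) := by
  have h1 : IsRadial (𝓕 f : 𝓢(Euc n, ℂ)) := by
    refine IsRadial.of_comp_isometry fun A => funext fun ξ => ?_
    rw [SchwartzMap.fourier_coe, Function.comp_apply, ← Real.fourier_comp_linearIsometry,
      h.comp_isometry]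
  intro x y hxy
  rw [fourierSchwartz_apply, fourierSchwartz_apply,
    h1 ((2 * Real.pi)⁻¹ • x) ((2 * Real.pi)⁻¹ • y) (by rw [norm_smul, norm_smul, hxy])]

theorem exists_fourierSchwartz_eq (v : 𝓢(Euc n, ℂ)) (hv : IsRadial v) :
    ∃ u : 𝓢(Euc n, ℂ), fourierSchwartz n u = v ∧ IsRadial u := by
  let w : 𝓢(Euc n, ℂ) := (fourierConst n)⁻¹ •
    compCLMOfContinuousLinearEquiv ℂ (fourierScaling n).symm v
  have hw : ∀ ξ, w ξ = (fourierConst n)⁻¹ * v ((2 * Real.pi) • ξ) := by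
    intro ξ
    have : (fourierScaling n).symm ξ = (2 * Real.pi) • ξ := by
      rw [ContinuousLinearEquiv.symm_apply_eq, fourierScaling_apply, smul_smul,
        inv_mul_cancel₀ (by positivity), one_smul]
    rw [← this]
    rfl
  refine ⟨𝓕⁻ w, ?_, ?_⟩
  · ext ξ
    rw [fourierSchwartz_apply, FourierTransform.fourier_fourierInv_eq, hw, smul_smul,
      mul_inv_cancel₀ (by positivity), one_smul, ← mul_assoc, mul_inv_cancel₀ fourierConst_ne_zero,
      one_mul]
  · have h1 : IsRadial w := fun x y hxy => by
      rw [hw, hw, hv ((2 * Real.pi) • x) ((2 * Real.pi) • y) (by rw [norm_smul, norm_smul, hxy])]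
    refine IsRadial.of_comp_isometry fun A => funext fun ξ => ?_
    rw [SchwartzMap.fourierInv_coe, Function.comp_apply, ← Real.fourierInv_comp_linearIsometry,
      h1.comp_isometry]

end Schwartz

/-! ### Truncation in the Schwartz topology -/

section Cutoff

open MeasureTheory SchwartzMap

variable {n : ℕ}

/-- A smooth radial cutoff equal to `1` on the unit ball. -/
noncomputable def cutoff (x : Euc n) : ℝ := Real.smoothTransition (2 - ‖x‖ ^ 2)

theorem contDiff_cutoff : ContDiff ℝ ∞ (cutoff (n := n)) :=
  Real.smoothTransition.contDiff.comp (contDiff_const.sub (contDiff_norm_sq ℝ))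

theorem cutoff_eq_one {x : Euc n} (hx : ‖x‖ ≤ 1) : cutoff x = 1 :=
  Real.smoothTransition.one_of_one_le (by nlinarith [norm_nonneg x])

theorem cutoff_eq_zero {x : Euc n} (hx : 2 ≤ ‖x‖) : cutoff x = 0 :=
  Real.smoothTransition.zero_of_nonpos (by nlinarith)

theorem abs_cutoff_le_one (x : Euc n) : |cutoff x| ≤ 1 := by
  rw [cutoff, abs_of_nonneg (Real.smoothTransition.nonneg _)]
  exact Real.smoothTransition.le_one _

theorem hasCompactSupport_cutoff_smul {r : ℝ} (hr : 0 < r) :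
    HasCompactSupport fun x : Euc n => cutoff (r • x) := by
  refine HasCompactSupport.intro (isCompact_closedBall (0 : Euc n) (2 / r)) fun x hx => ?_
  refine cutoff_eq_zero ?_
  rw [Metric.mem_closedBall, dist_zero_right, not_le, div_lt_iff₀ hr] at hx
  rw [norm_smul, Real.norm_of_nonneg hr.le]
  linarith

theorem contDiff_cutoff_smul (r : ℝ) : ContDiff ℝ ∞ fun x : Euc n => cutoff (r • x) :=
  contDiff_cutoff.comp (contDiff_const_smul r)

theorem hasTemperateGrowth_cutoff_smul {r : ℝ} (hr : 0 < r) :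
    (fun x : Euc n => cutoff (r • x)).HasTemperateGrowth :=
  (hasCompactSupport_cutoff_smul hr).hasTemperateGrowth (contDiff_cutoff_smul r)

theorem cutoff_congr {x y : Euc n} (h : ‖x‖ = ‖y‖) : cutoff x = cutoff y := by
  rw [cutoff, cutoff, h]

theorem exists_bound_iteratedFDeriv_cutoff (i : ℕ) :
    ∃ C, 0 ≤ C ∧ ∀ x : Euc n, ‖iteratedFDeriv ℝ i (fun x => cutoff x - 1) x‖ ≤ C := by
  have h0 : HasCompactSupport (cutoff (n := n)) := by
    simpa using hasCompactSupport_cutoff_smul (n := n) one_pos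
  let χ : 𝓢(Euc n, ℝ) := h0.toSchwartzMap contDiff_cutoff
  -- The extra `1` pays for the subtracted constant, which contributes only at order `i = 0`.
  refine ⟨SchwartzMap.seminorm ℝ 0 i χ + 1, by positivity, fun x => ?_⟩
  have h1 : ContDiffAt ℝ i (cutoff (n := n)) x :=
    (contDiff_cutoff.of_le (by exact_mod_cast le_top)).contDiffAt
  rw [fun_iteratedFDeriv_sub_apply h1 contDiffAt_const]
  refine (norm_sub_le _ _).trans (add_le_add ?_ ?_)
  · exact norm_iteratedFDeriv_le_seminorm ℝ χ i x
  · rcases Nat.eq_zero_or_pos i with rfl | hi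
    · simp
    · rw [iteratedFDeriv_const_of_ne hi.ne']
      simp

/-- Inside `‖r x‖ < 1` the function vanishes identically; outside, `1 ≤ r‖x‖` buys a factor `r` with
one extra power of `‖x‖`. -/
theorem norm_iteratedFDeriv_cutoff_smul_le (i : ℕ) :
    ∃ C, 0 ≤ C ∧ ∀ r : ℝ, 0 < r → r ≤ 1 → ∀ x : Euc n, ∀ k : ℕ,
      ‖x‖ ^ k * ‖iteratedFDeriv ℝ i (fun x => cutoff (r • x) - 1) x‖ ≤ C * r * ‖x‖ ^ (k + 1) := by
  obtain ⟨C, hC0, hC⟩ := exists_bound_iteratedFDeriv_cutoff (n := n) i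
  refine ⟨C, hC0, fun r hr0 hr1 x k => ?_⟩
  rcases lt_or_ge ‖r • x‖ 1 with h | h
  · have hev : (fun x : Euc n => cutoff (r • x) - 1) =ᶠ[𝓝 x] fun _ => 0 := by
      have hc : Continuous fun x : Euc n => ‖r • x‖ := by fun_prop
      filter_upwards [hc.continuousAt.eventually_lt continuousAt_const h] with y hy
      rw [cutoff_eq_one hy.le, sub_self]
    rw [(Filter.EventuallyEq.iteratedFDeriv ℝ hev i).eq_of_nhds]
    have : iteratedFDeriv ℝ i (fun _ : Euc n => (0 : ℝ)) x = 0 := by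
      rcases Nat.eq_zero_or_pos i with rfl | hi
      · ext; simp
      · rw [iteratedFDeriv_const_of_ne hi.ne']
        rfl
    rw [this]
    simp only [norm_zero, mul_zero]
    positivity
  · have hd : ContDiff ℝ i (fun x : Euc n => cutoff x - 1) :=
      (contDiff_cutoff.sub contDiff_const).of_le (by exact_mod_cast le_top)
    have e := congrFun (iteratedFDeriv_comp_const_smul r hd) x
    rw [e, norm_smul, norm_pow, Real.norm_of_nonneg hr0.le]
    rw [norm_smul, Real.norm_of_nonneg hr0.le] at h
    calc ‖x‖ ^ k * (r ^ i * ‖iteratedFDeriv ℝ i (fun x => cutoff x - 1) (r • x)‖)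
        ≤ ‖x‖ ^ k * (1 * C) := by
          gcongr
          · exact pow_le_one₀ hr0.le hr1
          · exact hC _
      _ ≤ ‖x‖ ^ k * (1 * C) * (r * ‖x‖) := le_mul_of_one_le_right (by positivity) h
      _ = C * r * ‖x‖ ^ (k + 1) := by ring

/-- Multiplication of a Schwartz function by the dilated cutoff. -/
noncomputable def truncate (k : ℕ) (u : 𝓢(Euc n, ℂ)) : 𝓢(Euc n, ℂ) :=
  smulLeftCLM ℂ (fun x : Euc n => cutoff (((k : ℝ) + 1)⁻¹ • x)) u

theorem truncate_apply (k : ℕ) (u : 𝓢(Euc n, ℂ)) (x : Euc n) :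
    truncate k u x = cutoff (((k : ℝ) + 1)⁻¹ • x) • u x :=
  smulLeftCLM_apply_apply (hasTemperateGrowth_cutoff_smul (by positivity)) u x

theorem truncate_mem (k : ℕ) {u : 𝓢(Euc n, ℂ)} (hu : IsRadial u) :
    (truncate k u : Euc n → ℂ) ∈ radialTest n := by
  refine ⟨(truncate k u).smooth', ?_, fun x y hxy => ?_⟩
  · refine (hasCompactSupport_cutoff_smul (n := n) (r := ((k : ℝ) + 1)⁻¹) (by positivity)).mono ?_
    intro x hx hx'
    apply hx
    simp only at hx'
    rw [truncate_apply, hx', zero_smul]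
  · rw [truncate_apply, truncate_apply, hu x y hxy, cutoff_congr]
    rw [norm_smul, norm_smul, hxy]

/-- By the Leibniz rule the error in the `(k, m)` seminorm is at most `1/(j+1)` times seminorms of
`u` with weight `k + 1`. -/
theorem tendsto_truncate (u : 𝓢(Euc n, ℂ)) :
    Filter.Tendsto (fun k => truncate k u) Filter.atTop (𝓝 u) := by
  rw [(schwartz_withSeminorms ℝ (Euc n) ℂ).tendsto_nhds]
  rintro ⟨k, m⟩ ε hε
  choose C hC0 hC using norm_iteratedFDeriv_cutoff_smul_le (n := n)
  set B := ∑ i ∈ Finset.range (m + 1), (m.choose i : ℝ) *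
    (C i * SchwartzMap.seminorm ℝ (k + 1) (m - i) u) with hB
  have hB0 : 0 ≤ B := Finset.sum_nonneg fun i _ => by
    have := hC0 i
    positivity
  have hbound : ∀ j : ℕ, SchwartzMap.seminorm ℝ k m (truncate j u - u) ≤
      ((j : ℝ) + 1)⁻¹ * B := by
    intro j
    set r := ((j : ℝ) + 1)⁻¹
    have hr0 : 0 < r := by positivity
    have hr1 : r ≤ 1 := inv_le_one_of_one_le₀ (by linarith [j.cast_nonneg (α := ℝ)])
    refine seminorm_le_bound ℝ k m _ (by positivity) fun x => ?_
    have e : ((truncate j u - u : 𝓢(Euc n, ℂ)) : Euc n → ℂ) =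
        fun x => (cutoff (r • x) - 1) • u x := by
      funext x
      rw [sub_apply, truncate_apply, sub_smul, one_smul]
    rw [e]
    refine (mul_le_mul_of_nonneg_left (norm_iteratedFDeriv_smul_le (𝕜 := ℝ) (N := ∞)
      ((contDiff_cutoff_smul r).sub contDiff_const) u.smooth' x (n := m)
      (by exact_mod_cast le_top)) (by positivity)).trans ?_
    rw [hB, Finset.mul_sum, Finset.mul_sum]
    refine Finset.sum_le_sum fun i _ => ?_
    have h1 := hC i r hr0 hr1 x k
    have h2 := le_seminorm ℝ (k + 1) (m - i) u x
    have h3 := hC0 i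
    calc ‖x‖ ^ k * (m.choose i * ‖iteratedFDeriv ℝ i (fun x => cutoff (r • x) - 1) x‖ *
          ‖iteratedFDeriv ℝ (m - i) u x‖)
        = m.choose i * (‖x‖ ^ k * ‖iteratedFDeriv ℝ i (fun x => cutoff (r • x) - 1) x‖) *
          ‖iteratedFDeriv ℝ (m - i) u x‖ := by ring
      _ ≤ m.choose i * (C i * r * ‖x‖ ^ (k + 1)) * ‖iteratedFDeriv ℝ (m - i) u x‖ := by gcongr
      _ = r * (m.choose i * (C i * (‖x‖ ^ (k + 1) * ‖iteratedFDeriv ℝ (m - i) u x‖))) := by ring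
      _ ≤ r * (m.choose i * (C i * SchwartzMap.seminorm ℝ (k + 1) (m - i) u)) := by gcongr
  have hlim : Filter.Tendsto (fun j : ℕ => ((j : ℝ) + 1)⁻¹ * B) Filter.atTop (𝓝 0) := by
    have := (tendsto_one_div_add_atTop_nhds_zero_nat (𝕜 := ℝ)).mul_const B
    simpa using this
  filter_upwards [hlim.eventually (gt_mem_nhds hε)] with j hj
  exact (hbound j).trans_lt hj

end Cutoff

/-! ### The isometric embedding of the energy space -/

section Embedding

open MeasureTheory SchwartzMap

variable {n : ℕ} {s₁ s₂ : ℝ}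

/-- The free wave operator in similarity variables on the Fourier side. -/
noncomputable def waveSchwartz (v : 𝓢(Euc n, ℂ) × 𝓢(Euc n, ℂ)) :
    𝓢(Euc n, ℂ) × 𝓢(Euc n, ℂ) :=
  (eulerSchwartz n v.1 + ((n : ℂ) - 1) • v.1 + v.2,
    -smulLeftCLM ℂ (fun ξ : Euc n => ‖ξ‖ ^ 2) v.1 + eulerSchwartz n v.2 + ((n : ℂ) - 2) • v.2)

theorem continuous_waveSchwartz : Continuous (waveSchwartz (n := n)) := by
  unfold waveSchwartz
  fun_prop

theorem waveSchwartz_fst (v : 𝓢(Euc n, ℂ) × 𝓢(Euc n, ℂ)) (ξ : Euc n) :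
    (waveSchwartz v).1 ξ = fderiv ℝ v.1 ξ ξ + (n - 1) * v.1 ξ + v.2 ξ := rfl

theorem waveSchwartz_snd (v : 𝓢(Euc n, ℂ) × 𝓢(Euc n, ℂ)) (ξ : Euc n) :
    (waveSchwartz v).2 ξ =
      -((‖ξ‖ ^ 2 : ℝ) : ℂ) * v.1 ξ + fderiv ℝ v.2 ξ ξ + (n - 2) * v.2 ξ := by
  have hg : (fun x : Euc n => ‖x‖ ^ 2).HasTemperateGrowth := by fun_prop
  have : (smulLeftCLM ℂ (fun ξ : Euc n => ‖ξ‖ ^ 2) v.1) ξ = ((‖ξ‖ ^ 2 : ℝ) : ℂ) * v.1 ξ := by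
    rw [smulLeftCLM_apply_apply hg, Complex.real_smul]
  rw [neg_mul, ← this]
  rfl

/-- Radial test functions as Schwartz functions. -/
noncomputable def testSchwartz (n : ℕ) : radialTest n →ₗ[ℂ] 𝓢(Euc n, ℂ) where
  toFun u := u.2.2.1.toSchwartzMap u.2.1
  map_add' _ _ := rfl
  map_smul' _ _ := rfl

theorem testSchwartz_eulerOp (u : radialTest n) :
    testSchwartz n (eulerOp n u) = eulerSchwartz n (testSchwartz n u) := rfl

theorem testSchwartz_laplaceOp (u : radialTest n) :
    testSchwartz n (laplaceOp n u) = Laplacian.laplacian (testSchwartz n u) := by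
  ext x
  rw [SchwartzMap.laplacian_apply]
  rfl

/-- The Fourier transform of a pair of radial test functions. -/
noncomputable def testFourier (h : Admissible n s₁ s₂) :
    TestPair h →ₗ[ℂ] 𝓢(Euc n, ℂ) × 𝓢(Euc n, ℂ) where
  toFun u := (fourierSchwartz n (testSchwartz n u.1), fourierSchwartz n (testSchwartz n u.2))
  map_add' u v := by
    change (fourierSchwartz n (testSchwartz n (u.1 + v.1)),
      fourierSchwartz n (testSchwartz n (u.2 + v.2))) = _
    simp only [map_add]
    rfl
  map_smul' c u := by
    change (fourierSchwartz n (testSchwartz n (c • u.1)),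
      fourierSchwartz n (testSchwartz n (c • u.2))) = _
    simp only [map_smul]
    rfl

/-- As `Λ` becomes `-(n + ξ·∇)`, the terms `-Λ - 1` and `-Λ - 2` become `ξ·∇ + n - 1` and `ξ·∇ + n -
2`. -/
theorem testFourier_waveOpTest (h : Admissible n s₁ s₂) (u : TestPair h) :
    testFourier h (waveOpTest h u) = waveSchwartz (testFourier h u) := by
  refine Prod.ext ?_ ?_
  · ext ξ
    rw [waveSchwartz_fst]
    change fourierSchwartz n (testSchwartz n (-eulerOp n u.1 - u.1 + u.2)) ξ =
      fderiv ℝ (fourierSchwartz n (testSchwartz n u.1)) ξ ξ +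
        (n - 1) * fourierSchwartz n (testSchwartz n u.1) ξ + fourierSchwartz n (testSchwartz n u.2) ξ
    simp only [map_add, map_sub, map_neg, testSchwartz_eulerOp, add_apply, sub_apply, neg_apply,
      fourierSchwartz_eulerSchwartz]
    ring
  · ext ξ
    rw [waveSchwartz_snd]
    change fourierSchwartz n (testSchwartz n (laplaceOp n u.1 - eulerOp n u.2 - (2 : ℂ) • u.2)) ξ =
      -((‖ξ‖ ^ 2 : ℝ) : ℂ) * fourierSchwartz n (testSchwartz n u.1) ξ +
        fderiv ℝ (fourierSchwartz n (testSchwartz n u.2)) ξ ξ +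
        (n - 2) * fourierSchwartz n (testSchwartz n u.2) ξ
    simp only [map_sub, map_smul, testSchwartz_eulerOp, testSchwartz_laplaceOp, sub_apply,
      smul_apply, smul_eq_mul, fourierSchwartz_eulerSchwartz, fourierSchwartz_laplacian]
    ring

/-- The parallelogram law for the two signs at each exponent; the factor `1/√2` normalises it. -/
theorem norm_modelFun_sq (v₁ v₂ : Euc n → ℂ) (ξ : Euc n) :
    ‖modelFun s₁ s₂ v₁ v₂ ξ‖ ^ 2 =
      (‖((‖ξ‖ ^ s₁ : ℝ) : ℂ) * v₁ ξ‖ ^ 2 + ‖((‖ξ‖ ^ s₂ : ℝ) : ℂ) * v₁ ξ‖ ^ 2) +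
      (‖((‖ξ‖ ^ (s₁ - 1) : ℝ) : ℂ) * v₂ ξ‖ ^ 2 + ‖((‖ξ‖ ^ (s₂ - 1) : ℝ) : ℂ) * v₂ ξ‖ ^ 2) := by
  have hp : ∀ a b : ℂ, ‖a - Complex.I * b‖ ^ 2 + ‖a + Complex.I * b‖ ^ 2 =
      2 * (‖a‖ ^ 2 + ‖b‖ ^ 2) := by
    intro a b
    have := parallelogram_law_with_norm ℝ a (Complex.I * b)
    rw [norm_mul, Complex.norm_I, one_mul] at this
    nlinarith
  have hq : (√2)⁻¹ ^ 2 = (1 / 2 : ℝ) := by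
    rw [inv_pow, Real.sq_sqrt (by norm_num)]
    norm_num
  have h1 := hp (((‖ξ‖ ^ s₁ : ℝ) : ℂ) * v₁ ξ) (((‖ξ‖ ^ (s₁ - 1) : ℝ) : ℂ) * v₂ ξ)
  have h2 := hp (((‖ξ‖ ^ s₂ : ℝ) : ℂ) * v₁ ξ) (((‖ξ‖ ^ (s₂ - 1) : ℝ) : ℂ) * v₂ ξ)
  rw [EuclideanSpace.norm_sq_eq, Fintype.sum_prod_type]
  simp only [Fintype.sum_bool, modelFun_apply, modeExp, modeSign, norm_mul (((√2)⁻¹ : ℝ) : ℂ),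
    mul_pow, Complex.norm_real, Real.norm_eq_abs, sq_abs, hq, if_true, Bool.false_eq_true, if_false,
    Complex.ofReal_one, Complex.ofReal_neg, mul_one, mul_neg, neg_mul, sub_neg_eq_add]
  simp only [norm_mul, Complex.norm_real, Real.norm_eq_abs, mul_pow, sq_abs] at h1 h2 ⊢
  linarith

theorem norm_modelMap_testFourier (h : Admissible n s₁ s₂) (h1 : 1 < s₁) (hs : s₁ ≤ s₂)
    (u : TestPair h) : ‖modelMap h1 hs (testFourier h u)‖ = ‖u‖ := by
  have hn := h.dim_pos
  have hn' : (0 : ℝ) ≤ n := n.cast_nonneg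
  have hint : ∀ s : ℝ, 0 < s → ∀ w : radialTest n,
      Integrable fun ξ => ‖weightedFourier s (w : Euc n → ℂ) ξ‖ ^ 2 := by
    intro s hs w
    have hm := memLp_weightedFourier hn (s := s) (by linarith) w.2
    exact (memLp_two_iff_integrable_sq_norm hm.1).mp hm
  have hM : ‖modelMap h1 hs (testFourier h u)‖ ^ 2 =
      ∫ ξ, ‖modelFun s₁ s₂ (testFourier h u).1 (testFourier h u).2 ξ‖ ^ 2 := by
    rw [@norm_sq_eq_re_inner ℂ, L2.inner_def]
    have : ∀ᵐ ξ, inner ℂ (modelMap h1 hs (testFourier h u) ξ) (modelMap h1 hs (testFourier h u) ξ) =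
        ((‖modelFun s₁ s₂ (testFourier h u).1 (testFourier h u).2 ξ‖ ^ 2 : ℝ) : ℂ) := by
      filter_upwards [modelMap_coeFn h1 hs (testFourier h u)] with ξ hξ
      rw [hξ, inner_self_eq_norm_sq_to_K]
      norm_cast
    rw [integral_congr_ae this, integral_complex_ofReal]
    simp
  have hU : ‖u‖ ^ 2 = (∫ ξ, ‖weightedFourier s₁ (u.1 : Euc n → ℂ) ξ‖ ^ 2) +
      (∫ ξ, ‖weightedFourier s₂ (u.1 : Euc n → ℂ) ξ‖ ^ 2) +
      ((∫ ξ, ‖weightedFourier (s₁ - 1) (u.2 : Euc n → ℂ) ξ‖ ^ 2) +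
      (∫ ξ, ‖weightedFourier (s₂ - 1) (u.2 : Euc n → ℂ) ξ‖ ^ 2)) := by
    rw [@norm_sq_eq_re_inner ℂ]
    change RCLike.re (pairInner u u) = _
    simp only [pairInner, sobolevInner_self, ← Complex.ofReal_add]
    simp
  have hpt : ∀ ξ, ‖modelFun s₁ s₂ (testFourier h u).1 (testFourier h u).2 ξ‖ ^ 2 =
      (‖weightedFourier s₁ (u.1 : Euc n → ℂ) ξ‖ ^ 2 +
        ‖weightedFourier s₂ (u.1 : Euc n → ℂ) ξ‖ ^ 2) +
      (‖weightedFourier (s₁ - 1) (u.2 : Euc n → ℂ) ξ‖ ^ 2 +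
        ‖weightedFourier (s₂ - 1) (u.2 : Euc n → ℂ) ξ‖ ^ 2) := by
    intro ξ
    rw [norm_modelFun_sq]
    have e1 : (testFourier h u).1 ξ = fourierT (u.1 : Euc n → ℂ) ξ :=
      fourierSchwartz_eq_fourierT (testSchwartz n u.1) ξ
    have e2 : (testFourier h u).2 ξ = fourierT (u.2 : Euc n → ℂ) ξ :=
      fourierSchwartz_eq_fourierT (testSchwartz n u.2) ξ
    rw [e1, e2]
    rfl
  have i1 := hint s₁ (by linarith) u.1
  have i2 := hint s₂ (by linarith) u.1
  have i3 := hint (s₁ - 1) (by linarith) u.2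
  have i4 := hint (s₂ - 1) (by linarith) u.2
  have hsq : ‖modelMap h1 hs (testFourier h u)‖ ^ 2 = ‖u‖ ^ 2 := by
    rw [hM, hU]
    simp only [hpt]
    exact (integral_add (i1.add i2) (i3.add i4)).trans
      (congrArg₂ (· + ·) (integral_add i1 i2) (integral_add i3 i4))
  exact (sq_eq_sq₀ (norm_nonneg _) (norm_nonneg _)).mp hsq

/-- The isometric embedding of `H_{s₁,s₂}` into the model space. -/
noncomputable def energyEmb (h : Admissible n s₁ s₂) (h1 : 1 < s₁) (hs : s₁ ≤ s₂) :
    EnergySpace h →ₗᵢ[ℂ] ModelSpace n :=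
  let f : TestPair h →L[ℂ] ModelSpace n :=
    (LinearIsometry.mk ((modelMap h1 hs).toLinearMap ∘ₗ testFourier h)
      (norm_modelMap_testFourier h h1 hs)).toContinuousLinearMap
  { (f.extend (UniformSpace.Completion.toComplL (𝕜 := ℂ) (E := TestPair h))).toLinearMap with
    norm_map' := fun x => by
      have hd : DenseRange (UniformSpace.Completion.toComplL (𝕜 := ℂ) (E := TestPair h)) :=
        UniformSpace.Completion.denseRange_coe
      have hi : IsUniformInducing (UniformSpace.Completion.toComplL (𝕜 := ℂ) (E := TestPair h)) :=
        UniformSpace.Completion.isUniformInducing_coe _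
      change ‖f.extend (UniformSpace.Completion.toComplL (𝕜 := ℂ) (E := TestPair h)) x‖ = ‖x‖
      refine UniformSpace.Completion.induction_on x (isClosed_eq (by fun_prop) (by fun_prop))
        fun u => ?_
      have := f.extend_eq hd hi u
      change f.extend (UniformSpace.Completion.toComplL (𝕜 := ℂ) (E := TestPair h)) u = _ at this
      rw [this, UniformSpace.Completion.norm_coe]
      exact norm_modelMap_testFourier h h1 hs u }

theorem energyEmb_testEmb (h : Admissible n s₁ s₂) (h1 : 1 < s₁) (hs : s₁ ≤ s₂) (u : TestPair h) :
    energyEmb h h1 hs (testEmb h u) = modelMap h1 hs (testFourier h u) := by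
  have hd : DenseRange (UniformSpace.Completion.toComplL (𝕜 := ℂ) (E := TestPair h)) :=
    UniformSpace.Completion.denseRange_coe
  have hi : IsUniformInducing (UniformSpace.Completion.toComplL (𝕜 := ℂ) (E := TestPair h)) :=
    UniformSpace.Completion.isUniformInducing_coe _
  exact ContinuousLinearMap.extend_eq _ hd hi u

end Embedding

/-! ### The invariant core of frequency-localised data -/

section FreqCore

open MeasureTheory SchwartzMap

variable {n : ℕ} {s₁ s₂ : ℝ}

/-- Radial test functions on the Fourier side that vanish near the origin. -/
def IsFreqTest (v : Euc n → ℂ) : Prop := v ∈ radialTest n ∧ ∀ᶠ ξ in 𝓝 0, v ξ = 0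

theorem IsFreqTest.add {v w : Euc n → ℂ} (hv : IsFreqTest v) (hw : IsFreqTest w) :
    IsFreqTest (v + w) := by
  refine ⟨Submodule.add_mem _ hv.1 hw.1, ?_⟩
  filter_upwards [hv.2, hw.2] with ξ h1 h2
  rw [Pi.add_apply, h1, h2, add_zero]

/-- The norm fails to be smooth only at the origin, near which `v (r • ξ)` vanishes; hence
smoothness of `g` on `(0, ∞)` is enough. -/
theorem IsFreqTest.mul_comp_smul {v : Euc n → ℂ} (hv : IsFreqTest v) {g : ℝ → ℝ}
    (hg : ContDiffOn ℝ ∞ g (Set.Ioi 0)) {r : ℝ} (hr : 0 < r) :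
    IsFreqTest fun ξ => (g ‖ξ‖ : ℂ) * v (r • ξ) := by
  obtain ⟨⟨h1, h2, h3⟩, h4⟩ := hv
  have h5 : ∀ᶠ ξ : Euc n in 𝓝 0, v (r • ξ) = 0 := by
    have : Filter.Tendsto (fun ξ : Euc n => r • ξ) (𝓝 0) (𝓝 0) :=
      (continuous_const_smul r).tendsto' 0 0 (smul_zero r)
    exact this.eventually h4
  have h6 : ∀ᶠ ξ : Euc n in 𝓝 0, (g ‖ξ‖ : ℂ) * v (r • ξ) = 0 := by
    filter_upwards [h5] with ξ hξ
    rw [hξ, mul_zero]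
  refine ⟨⟨?_, ?_, ?_⟩, h6⟩
  · rw [contDiff_iff_contDiffAt]
    intro ξ
    rcases eq_or_ne ξ 0 with rfl | hξ
    · exact (contDiffAt_const (c := (0 : ℂ))).congr_of_eventuallyEq h6
    · refine ContDiffAt.mul ?_ (h1.contDiffAt.comp ξ (contDiff_const_smul r).contDiffAt)
      refine Complex.ofRealCLM.contDiff.contDiffAt.comp ξ ?_
      exact (hg.contDiffAt (Ioi_mem_nhds (norm_pos_iff.mpr hξ))).comp ξ (contDiffAt_norm ℝ hξ)
  · refine HasCompactSupport.mul_left ?_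
    exact h2.comp_homeomorph (Homeomorph.smulOfNeZero r hr.ne')
  · intro x y hxy
    simp only
    rw [hxy, h3 (r • x) (r • y) (by rw [norm_smul, norm_smul, hxy])]

/-- Schwartz function attached to a compactly supported function on the Fourier side. -/
noncomputable def IsFreqTest.toSchwartz {v : Euc n → ℂ} (hv : IsFreqTest v) : 𝓢(Euc n, ℂ) :=
  hv.1.2.1.toSchwartzMap hv.1.1

@[simp]
theorem IsFreqTest.toSchwartz_coe {v : Euc n → ℂ} (hv : IsFreqTest v) :
    (hv.toSchwartz : Euc n → ℂ) = v := rfl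

/-- The states whose Fourier transforms are smooth with compact support away from the origin. -/
def freqCore (n : ℕ) (h1 : 1 < s₁) (hs : s₁ ≤ s₂) : Set (ModelSpace n) :=
  {f | ∃ v : 𝓢(Euc n, ℂ) × 𝓢(Euc n, ℂ), IsFreqTest v.1 ∧ IsFreqTest v.2 ∧ modelMap h1 hs v = f}

/-- First component of the explicit free evolution on the Fourier side. -/
noncomputable def evolFst (τ : ℝ) (v₁ v₂ : Euc n → ℂ) : Euc n → ℂ :=
  (fun ξ => ((Real.exp ((n - 1) * τ) * Real.cos ((Real.exp τ - 1) * ‖ξ‖) : ℝ) : ℂ) *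
      v₁ (Real.exp τ • ξ)) +
    fun ξ => ((Real.exp ((n - 2) * τ) * (Real.sin ((Real.exp τ - 1) * ‖ξ‖) / ‖ξ‖) : ℝ) : ℂ) *
      v₂ (Real.exp τ • ξ)

/-- Second component of the explicit free evolution on the Fourier side. -/
noncomputable def evolSnd (τ : ℝ) (v₁ v₂ : Euc n → ℂ) : Euc n → ℂ :=
  (fun ξ => ((-Real.exp ((n - 1) * τ) * (Real.sin ((Real.exp τ - 1) * ‖ξ‖) * ‖ξ‖) : ℝ) : ℂ) *
      v₁ (Real.exp τ • ξ)) +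
    fun ξ => ((Real.exp ((n - 2) * τ) * Real.cos ((Real.exp τ - 1) * ‖ξ‖) : ℝ) : ℂ) *
      v₂ (Real.exp τ • ξ)

theorem isFreqTest_evolFst (τ : ℝ) {v₁ v₂ : Euc n → ℂ} (h₁ : IsFreqTest v₁) (h₂ : IsFreqTest v₂) :
    IsFreqTest (evolFst τ v₁ v₂) := by
  refine IsFreqTest.add ?_ ?_
  · refine h₁.mul_comp_smul
      (g := fun ρ => Real.exp ((n - 1) * τ) * Real.cos ((Real.exp τ - 1) * ρ)) ?_ (Real.exp_pos τ)
    fun_prop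
  · refine h₂.mul_comp_smul
      (g := fun ρ => Real.exp ((n - 2) * τ) * (Real.sin ((Real.exp τ - 1) * ρ) / ρ)) ?_
      (Real.exp_pos τ)
    exact contDiffOn_const.mul (ContDiffOn.div (by fun_prop) contDiffOn_id fun ρ hρ => ne_of_gt hρ)

theorem isFreqTest_evolSnd (τ : ℝ) {v₁ v₂ : Euc n → ℂ} (h₁ : IsFreqTest v₁) (h₂ : IsFreqTest v₂) :
    IsFreqTest (evolSnd τ v₁ v₂) := by
  refine IsFreqTest.add ?_ ?_
  · refine h₁.mul_comp_smul
      (g := fun ρ => -Real.exp ((n - 1) * τ) * (Real.sin ((Real.exp τ - 1) * ρ) * ρ)) ?_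
      (Real.exp_pos τ)
    fun_prop
  · refine h₂.mul_comp_smul
      (g := fun ρ => Real.exp ((n - 2) * τ) * Real.cos ((Real.exp τ - 1) * ρ)) ?_ (Real.exp_pos τ)
    fun_prop

/-- Euler's formula turns the phases into the propagators `cos`, `sin / |ξ|` and `|ξ| sin`. The
evolved modes again come from a single pair, common to both exponents and both signs. -/
theorem evolFun_modelFun (h1 : 1 < s₁) (hs : s₁ ≤ s₂) (τ : ℝ) {v₁ v₂ : Euc n → ℂ} (h₁ : v₁ 0 = 0)
    (h₂ : v₂ 0 = 0) (ξ : Euc n) :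
    evolFun s₁ s₂ τ (modelFun s₁ s₂ v₁ v₂) ξ =
      modelFun s₁ s₂ (evolFst τ v₁ v₂) (evolSnd τ v₁ v₂) ξ := by
  ext k
  -- At the origin `sin θ / ‖ξ‖` has the default value `0`; this is harmless since the data vanish
  -- there.
  rcases eq_or_ne ξ 0 with rfl | hξ
  · simp [evolFst, evolSnd, h₁, h₂]
  have hξ' : ‖ξ‖ ≠ 0 := norm_ne_zero_iff.mpr hξ
  have hsk : 1 < modeExp s₁ s₂ k := h1.trans_le (le_modeExp hs k)
  rw [evolFun_apply, modelFun_apply, modelFun_apply, norm_dilation_rpow, norm_dilation_rpow,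
    evolMult]
  set s := modeExp s₁ s₂ k
  simp only [evolFst, evolSnd, Pi.add_apply]
  set θ := (Real.exp τ - 1) * ‖ξ‖
  -- The sign leaves the trigonometric functions by parity.
  have hmult : Complex.exp ((((n - 1 - s) * τ : ℝ) : ℂ) + ((modeSign k * θ : ℝ) : ℂ) * Complex.I) =
      (Real.exp ((n - 1 - s) * τ) : ℂ) *
        ((Real.cos θ : ℂ) + (modeSign k : ℂ) * (Real.sin θ : ℂ) * Complex.I) := by
    rw [Complex.exp_add, Complex.exp_mul_I, ← Complex.ofReal_exp, ← Complex.ofReal_cos,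
      ← Complex.ofReal_sin]
    congr 1
    unfold modeSign
    split_ifs <;> simp
  have ha : Real.exp ((n - 1) * τ) = Real.exp ((n - 1 - s) * τ) * Real.exp (s * τ) := by
    rw [← Real.exp_add]
    congr 1
    ring
  have hb : Real.exp ((n - 2) * τ) = Real.exp ((n - 1 - s) * τ) * Real.exp ((s - 1) * τ) := by
    rw [← Real.exp_add]
    congr 1
    ring
  have hR : ‖ξ‖ ^ s = ‖ξ‖ * ‖ξ‖ ^ (s - 1) := by
    conv_rhs => rw [← Real.rpow_one_add' (norm_nonneg ξ) (by linarith)]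
    congr 1
    ring
  have hξ'' : (‖ξ‖ : ℂ) ≠ 0 := by exact_mod_cast hξ'
  have hσ : (modeSign k : ℂ) * (modeSign k : ℂ) = 1 := by exact_mod_cast modeSign_sq k
  rw [hmult, ha, hb, hR]
  simp only [Complex.ofReal_mul, Complex.ofReal_neg, Complex.ofReal_div]
  generalize v₁ (Real.exp τ • ξ) = V₁
  generalize v₂ (Real.exp τ • ξ) = V₂
  generalize ((‖ξ‖ ^ (s - 1) : ℝ) : ℂ) = ρ
  have hD : (‖ξ‖ : ℂ) * ((Real.sin θ : ℂ) / ‖ξ‖) = Real.sin θ := mul_div_cancel₀ _ hξ''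
  have hI : Complex.I * Complex.I = -1 := Complex.I_mul_I
  linear_combination (-(Real.exp ((n - 1 - s) * τ) * ((√2)⁻¹ : ℝ) * Real.exp ((s - 1) * τ) * ρ *
    V₂ : ℂ)) * ((modeSign k : ℂ) ^ 2 * Real.sin θ * hI - Real.sin θ * hσ + hD)

theorem modelEvol_mem_freqCore (h1 : 1 < s₁) (hs : s₁ ≤ s₂) (τ : ℝ≥0) {f : ModelSpace n}
    (hf : f ∈ freqCore n h1 hs) : modelEvol hs τ f ∈ freqCore n h1 hs := by
  obtain ⟨v, hv₁, hv₂, rfl⟩ := hf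
  have e₁ := isFreqTest_evolFst τ hv₁ hv₂
  have e₂ := isFreqTest_evolSnd τ hv₁ hv₂
  refine ⟨(e₁.toSchwartz, e₂.toSchwartz), e₁, e₂, Lp.ext ?_⟩
  refine (modelMap_coeFn h1 hs _).trans (Filter.EventuallyEq.trans ?_
    ((modelEvol_coeFn hs τ _).trans (evolFun_congr_ae (modelMap_coeFn h1 hs v))).symm)
  refine Filter.Eventually.of_forall fun ξ => ?_
  rw [evolFun_modelFun h1 hs τ hv₁.2.self_of_nhds hv₂.2.self_of_nhds]
  rfl

/-- A radial frequency cutoff vanishing near the origin. -/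
noncomputable def freqCutoff (k : ℕ) (ξ : Euc n) : ℝ :=
  cutoff (((k : ℝ) + 1)⁻¹ • ξ) * (1 - cutoff (((k : ℝ) + 1) • ξ))

theorem abs_freqCutoff_le (k : ℕ) (ξ : Euc n) : |freqCutoff k ξ| ≤ 2 := by
  rw [freqCutoff, abs_mul]
  have h1 := abs_cutoff_le_one (((k : ℝ) + 1)⁻¹ • ξ)
  have h2 := abs_cutoff_le_one (((k : ℝ) + 1) • ξ)
  have h3 : |1 - cutoff (((k : ℝ) + 1) • ξ)| ≤ 2 := by
    rw [abs_le] at h2 ⊢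
    constructor <;> linarith
  calc _ ≤ 1 * 2 := mul_le_mul h1 h3 (abs_nonneg _) zero_le_one
    _ = 2 := one_mul 2

theorem tendsto_freqCutoff {ξ : Euc n} (hξ : ξ ≠ 0) :
    Filter.Tendsto (fun k => freqCutoff k ξ) Filter.atTop (𝓝 1) := by
  have hpos : 0 < ‖ξ‖ := norm_pos_iff.mpr hξ
  refine tendsto_const_nhds.congr' ?_
  -- The first threshold puts `ξ / (k + 1)` in the unit ball, the second puts `(k + 1) ξ` outside
  -- radius `2`; the cutoff is then exactly `1`.
  filter_upwards [Filter.eventually_ge_atTop ⌈‖ξ‖⌉₊, Filter.eventually_ge_atTop ⌈2 / ‖ξ‖⌉₊]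
    with k hk1 hk2
  have hk : (0 : ℝ) < (k : ℝ) + 1 := by positivity
  have e1 : ‖ξ‖ ≤ k := (Nat.le_ceil _).trans (by exact_mod_cast hk1)
  have e2 : 2 / ‖ξ‖ ≤ k := (Nat.le_ceil _).trans (by exact_mod_cast hk2)
  rw [div_le_iff₀ hpos] at e2
  rw [freqCutoff, cutoff_eq_one, cutoff_eq_zero]
  · simp
  · rw [norm_smul, Real.norm_of_nonneg hk.le]
    linarith
  · rw [norm_smul, norm_inv, Real.norm_of_nonneg hk.le, inv_mul_le_iff₀ hk]
    linarith

theorem isFreqTest_freqCutoff_mul (k : ℕ) {v : 𝓢(Euc n, ℂ)} (hv : IsRadial v) :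
    IsFreqTest fun ξ => (freqCutoff k ξ : ℂ) * v ξ := by
  have hk : (0 : ℝ) < (k : ℝ) + 1 := by positivity
  refine ⟨⟨?_, ?_, ?_⟩, ?_⟩
  · refine ContDiff.mul (Complex.ofRealCLM.contDiff.comp ?_) v.smooth'
    exact (contDiff_cutoff_smul _).mul (contDiff_const.sub (contDiff_cutoff_smul _))
  · refine (hasCompactSupport_cutoff_smul (n := n) (inv_pos.mpr hk)).mono ?_
    intro ξ hξ h0
    apply hξ
    simp only at h0
    simp [freqCutoff, h0]
  · intro x y hxy
    simp only
    rw [hv x y hxy, freqCutoff, freqCutoff, cutoff_congr (y := ((k : ℝ) + 1)⁻¹ • y),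
      cutoff_congr (x := ((k : ℝ) + 1) • x) (y := ((k : ℝ) + 1) • y)]
    · rw [norm_smul, norm_smul, hxy]
    · rw [norm_smul, norm_smul, hxy]
  · have hc : Continuous fun ξ : Euc n => ‖((k : ℝ) + 1) • ξ‖ := by fun_prop
    have h0 : ‖((k : ℝ) + 1) • (0 : Euc n)‖ < 1 := by simp
    filter_upwards [hc.continuousAt.eventually_lt continuousAt_const h0] with ξ hξ
    simp [freqCutoff, cutoff_eq_one hξ.le]

/-- The frequency cutoffs are bounded and tend to `1` off the origin, a null set, so dominated
convergence applies. -/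
theorem modelMap_mem_closure_freqCore (hn : 0 < n) (h1 : 1 < s₁) (hs : s₁ ≤ s₂)
    {v : 𝓢(Euc n, ℂ) × 𝓢(Euc n, ℂ)} (hv₁ : IsRadial v.1) (hv₂ : IsRadial v.2) :
    modelMap h1 hs v ∈ closure (freqCore n h1 hs) := by
  have : Nonempty (Fin n) := ⟨⟨0, hn⟩⟩
  let w : ℕ → 𝓢(Euc n, ℂ) × 𝓢(Euc n, ℂ) := fun k =>
    ((isFreqTest_freqCutoff_mul k hv₁).toSchwartz, (isFreqTest_freqCutoff_mul k hv₂).toSchwartz)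
  refine mem_closure_of_tendsto (f := fun k => modelMap h1 hs (w k)) (b := Filter.atTop) ?_
    (Filter.Eventually.of_forall fun k => ⟨w k, isFreqTest_freqCutoff_mul k hv₁,
      isFreqTest_freqCutoff_mul k hv₂, rfl⟩)
  have hF : ∀ k ξ, modelFun s₁ s₂ (w k).1 (w k).2 ξ =
      (freqCutoff k ξ : ℂ) • modelFun s₁ s₂ v.1 v.2 ξ := by
    intro k ξ
    ext j
    rw [PiLp.smul_apply, modelFun_apply, modelFun_apply, smul_eq_mul]
    simp only [w, IsFreqTest.toSchwartz_coe]
    ring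
  refine tendsto_Lp_two_of_dominated
    (F := fun k ξ => (freqCutoff k ξ : ℂ) • modelFun s₁ s₂ v.1 v.2 ξ) (fun k => ?_)
    -- `3 = 2 + 1`: the bound on the cutoff plus the limit itself.
    ((memLp_modelFun h1 hs v.1 v.2).norm.const_mul 3) (Filter.Eventually.of_forall fun k => ?_) ?_
  · filter_upwards [modelMap_coeFn h1 hs (w k)] with ξ hξ
    rw [hξ, hF]
  · filter_upwards [modelMap_coeFn h1 hs v] with ξ hξ
    rw [hξ]
    refine (norm_sub_le _ _).trans ?_
    rw [norm_smul, Complex.norm_real, Real.norm_eq_abs]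
    have := mul_le_mul_of_nonneg_right (abs_freqCutoff_le k ξ)
      (norm_nonneg (modelFun s₁ s₂ v.1 v.2 ξ))
    linarith
  · have h0 : ∀ᵐ ξ : Euc n, ξ ≠ 0 := by
      simp [MeasureTheory.ae_iff]
    filter_upwards [modelMap_coeFn h1 hs v, h0] with ξ hξ hξ0
    rw [hξ]
    have h2 : Filter.Tendsto (fun k => (freqCutoff k ξ : ℂ)) Filter.atTop (𝓝 1) := by
      have := (Complex.continuous_ofReal.tendsto 1).comp (tendsto_freqCutoff hξ0)
      rwa [Complex.ofReal_one] at this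
    have := h2.smul_const (modelFun s₁ s₂ v.1 v.2 ξ)
    rwa [one_smul] at this

/-- States in the frequency core are limits, in the graph norm of the free wave operator, of pairs
of radial test functions. -/
theorem exists_tendsto_of_freqCore (h : Admissible n s₁ s₂) (h1 : 1 < s₁) (hs : s₁ ≤ s₂)
    {f : ModelSpace n} (hf : f ∈ freqCore n h1 hs) :
    ∃ (u : ℕ → TestPair h) (g : ModelSpace n),
      Filter.Tendsto (fun k => modelMap h1 hs (testFourier h (u k))) Filter.atTop (𝓝 f) ∧
      Filter.Tendsto (fun k => modelMap h1 hs (testFourier h (waveOpTest h (u k)))) Filter.atTop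
        (𝓝 g) := by
  obtain ⟨v, hv₁, hv₂, rfl⟩ := hf
  obtain ⟨u₁, hu₁, hr₁⟩ := exists_fourierSchwartz_eq v.1 hv₁.1.2.2
  obtain ⟨u₂, hu₂, hr₂⟩ := exists_fourierSchwartz_eq v.2 hv₂.1.2.2
  let u : ℕ → TestPair h := fun k =>
    (⟨truncate k u₁, truncate_mem k hr₁⟩, ⟨truncate k u₂, truncate_mem k hr₂⟩)
  have hlim : Filter.Tendsto (fun k => testFourier h (u k)) Filter.atTop (𝓝 v) := by
    have e : ∀ k, testFourier h (u k) =
        (fourierSchwartz n (truncate k u₁), fourierSchwartz n (truncate k u₂)) := fun k => rfl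
    simp only [e]
    have hv : v = (fourierSchwartz n u₁, fourierSchwartz n u₂) := by rw [hu₁, hu₂]
    rw [hv]
    exact (((fourierSchwartz n).continuous.tendsto u₁).comp (tendsto_truncate u₁)).prodMk_nhds
      (((fourierSchwartz n).continuous.tendsto u₂).comp (tendsto_truncate u₂))
  -- Truncations converge in the Schwartz topology, on which the Fourier transform, the Fourier-side
  -- operator and `modelMap` are all continuous; both limits follow at once.
  refine ⟨u, modelMap h1 hs (waveSchwartz v), ?_, ?_⟩
  · exact ((modelMap h1 hs).continuous.tendsto v).comp hlim
  · simp only [testFourier_waveOpTest]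
    exact (((modelMap h1 hs).continuous.comp continuous_waveSchwartz).tendsto v).comp hlim

end FreqCore

/-! ### Transfer of the evolution to the energy space -/

section Main

variable {n : ℕ} {s₁ s₂ : ℝ}

theorem testFourier_isRadial (h : Admissible n s₁ s₂) (u : TestPair h) :
    IsRadial (testFourier h u).1 ∧ IsRadial (testFourier h u).2 :=
  ⟨IsRadial.fourierSchwartz (f := testSchwartz n u.1) u.1.2.2.2,
    IsRadial.fourierSchwartz (f := testSchwartz n u.2) u.2.2.2.2⟩

theorem isClosed_range_energyEmb (h : Admissible n s₁ s₂) (h1 : 1 < s₁) (hs : s₁ ≤ s₂) :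
    IsClosed (Set.range (energyEmb h h1 hs)) :=
  (energyEmb h h1 hs).isometry.isClosedEmbedding.isClosed_range

theorem freqCore_subset_range (h : Admissible n s₁ s₂) (h1 : 1 < s₁) (hs : s₁ ≤ s₂) :
    freqCore n h1 hs ⊆ Set.range (energyEmb h h1 hs) := by
  intro f hf
  obtain ⟨u, -, hu, -⟩ := exists_tendsto_of_freqCore h h1 hs hf
  refine (isClosed_range_energyEmb h h1 hs).mem_of_tendsto hu
    (Filter.Eventually.of_forall fun k => ?_)
  exact ⟨testEmb h (u k), energyEmb_testEmb h h1 hs (u k)⟩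

theorem energyEmb_mem_closure (h : Admissible n s₁ s₂) (h1 : 1 < s₁) (hs : s₁ ≤ s₂)
    (x : EnergySpace h) : energyEmb h h1 hs x ∈ closure (freqCore n h1 hs) := by
  refine UniformSpace.Completion.induction_on x
    (isClosed_closure.preimage (energyEmb h h1 hs).continuous) fun u => ?_
  have := energyEmb_testEmb h h1 hs u
  change energyEmb h h1 hs (u : EnergySpace h) = _ at this
  rw [this]
  exact modelMap_mem_closure_freqCore h.dim_pos h1 hs (testFourier_isRadial h u).1
    (testFourier_isRadial h u).2

/-- The image of the energy space is closed and lies in the closure of the core, which it contains;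
invariance of the core therefore passes to the whole image. -/
theorem modelEvol_energyEmb_mem_range (h : Admissible n s₁ s₂) (h1 : 1 < s₁) (hs : s₁ ≤ s₂)
    (τ : ℝ≥0) (x : EnergySpace h) :
    modelEvol hs τ (energyEmb h h1 hs x) ∈ LinearMap.range (energyEmb h h1 hs).toLinearMap := by
  have h2 : modelEvol hs τ (energyEmb h h1 hs x) ∈ closure (freqCore n h1 hs) :=
    map_mem_closure (modelEvol hs τ).continuous (energyEmb_mem_closure h h1 hs x)
      fun f hf => modelEvol_mem_freqCore h1 hs τ hf
  exact closure_minimal (freqCore_subset_range h h1 hs) (isClosed_range_energyEmb h h1 hs) h2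

/-- The free evolution in similarity variables on `H_{s₁,s₂}`. -/
noncomputable def energyEvol (h : Admissible n s₁ s₂) (h1 : 1 < s₁) (hs : s₁ ≤ s₂) (τ : ℝ≥0) :
    EnergySpace h →L[ℂ] EnergySpace h :=
  (energyEmb h h1 hs).equivRange.symm.toContinuousLinearEquiv.toContinuousLinearMap ∘L
    ((modelEvol hs τ ∘L (energyEmb h h1 hs).toContinuousLinearMap).codRestrict
      (LinearMap.range (energyEmb h h1 hs).toLinearMap)
      (modelEvol_energyEmb_mem_range h h1 hs τ))

theorem energyEmb_energyEvol (h : Admissible n s₁ s₂) (h1 : 1 < s₁) (hs : s₁ ≤ s₂) (τ : ℝ≥0)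
    (x : EnergySpace h) :
    energyEmb h h1 hs (energyEvol h h1 hs τ x) = modelEvol hs τ (energyEmb h h1 hs x) :=
  congrArg Subtype.val ((energyEmb h h1 hs).equivRange.apply_symm_apply
    ⟨modelEvol hs τ (energyEmb h h1 hs x), modelEvol_energyEmb_mem_range h h1 hs τ x⟩)

theorem norm_energyEvol_le (h : Admissible n s₁ s₂) (h1 : 1 < s₁) (hs : s₁ ≤ s₂) (τ : ℝ≥0)
    (x : EnergySpace h) :
    ‖energyEvol h h1 hs τ x‖ ≤ Real.exp (((n : ℝ) / 2 - 1 - s₁) * τ) * ‖x‖ := by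
  rw [← (energyEmb h h1 hs).norm_map, energyEmb_energyEvol, ← (energyEmb h h1 hs).norm_map x]
  exact norm_modelEvol_le hs τ _

theorem tendsto_energyEmb_iff (h : Admissible n s₁ s₂) (h1 : 1 < s₁) (hs : s₁ ≤ s₂) {ι : Type*}
    {l : Filter ι} {f : ι → EnergySpace h} {x : EnergySpace h} :
    Filter.Tendsto f l (𝓝 x) ↔
      Filter.Tendsto (fun i => energyEmb h h1 hs (f i)) l (𝓝 (energyEmb h h1 hs x)) :=
  (energyEmb h h1 hs).isometry.isEmbedding.tendsto_nhds_iff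

theorem mem_graph_freeWaveOp (h : Admissible n s₁ s₂) (u : TestPair h) :
    (testEmb h u, testEmb h (waveOpTest h u)) ∈ (freeWaveOp h).graph := by
  rw [← freeWaveOp_apply]
  exact (freeWaveOp h).mem_graph ⟨testEmb h u, LinearMap.mem_range_self _ u⟩

theorem freeWave_generates (h : Admissible n s₁ s₂) (h1 : 1 < s₁) (hs : s₁ ≤ s₂) :
    IsC0Semigroup (energyEvol h h1 hs) ∧ (freeWaveOp h).IsClosable ∧
      IsGenerator (energyEvol h h1 hs) (freeWaveOp h).closure := by
  have hinj := (energyEmb h h1 hs).injective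
  refine isGenerator_closure_of_invariant (β := n / 2 - 1 - s₁)
    (D := energyEmb h h1 hs ⁻¹' freqCore n h1 hs) ?_ ?_ ?_ ?_ ?_ ?_ ?_ ?_
  · ext x
    apply hinj
    rw [energyEmb_energyEvol, modelEvol_zero]
    rfl
  · intro σ τ
    ext x
    apply hinj
    rw [energyEmb_energyEvol, modelEvol_add, ContinuousLinearMap.comp_apply, energyEmb_energyEvol,
      energyEmb_energyEvol]
  · exact norm_energyEvol_le h h1 hs
  · exact UniformSpace.Completion.denseRange_coe
  · intro x y hxy
    obtain ⟨⟨x', hx'⟩, rfl, rfl⟩ := (freeWaveOp h).mem_graph_iff.mp hxy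
    obtain ⟨u, rfl⟩ := hx'
    rw [freeWaveOp_apply, tendsto_energyEmb_iff h h1 hs, energyEmb_testEmb]
    simp only [map_smul, map_sub, energyEmb_energyEvol, energyEmb_testEmb]
    rw [testFourier_waveOpTest]
    exact tendsto_quotient_modelMap h1 hs (waveSchwartz_fst _) (waveSchwartz_snd _)
  · intro x
    rw [(energyEmb h h1 hs).isometry.isEmbedding.isInducing.closure_eq_preimage_closure_image,
      Set.mem_preimage, Set.image_preimage_eq_of_subset (freqCore_subset_range h h1 hs)]
    exact energyEmb_mem_closure h h1 hs x
  · intro τ x hx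
    rw [Set.mem_preimage, energyEmb_energyEvol]
    exact modelEvol_mem_freqCore h1 hs τ hx
  · intro x hx
    obtain ⟨u, g, hu, hg⟩ := exists_tendsto_of_freqCore h h1 hs hx
    simp only [← energyEmb_testEmb] at hu hg
    -- The limit `g` exists a priori only in the model space; closedness of the image brings it back
    -- to the energy space.
    obtain ⟨y, rfl⟩ := (isClosed_range_energyEmb h h1 hs).mem_of_tendsto hg
      (Filter.Eventually.of_forall fun k => ⟨_, rfl⟩)
    refine ⟨y, mem_closure_of_tendsto (Filter.Tendsto.prodMk_nhds
      ((tendsto_energyEmb_iff h h1 hs).mpr hu) ((tendsto_energyEmb_iff h h1 hs).mpr hg))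
      (Filter.Eventually.of_forall fun k => mem_graph_freeWaveOp h (u k))⟩

end Main

end FreeWave

theorem proposition4p1 (n : ℕ) (s₁ s₂ : ℝ) (hn : 3 ≤ n) (hs₁ : 1 < s₁)
    (hs₁' : s₁ < (n : ℝ) / 2) (hs₂ : (n : ℝ) / 2 + 1 < s₂) :
    let h : FreeWave.Admissible n s₁ s₂ := FreeWave.Admissible.of_bounds hn hs₁ hs₂
    (FreeWave.freeWaveOp h).IsClosable ∧
      ∃ S : NNReal → FreeWave.EnergySpace h →L[ℂ] FreeWave.EnergySpace h,
        FreeWave.IsC0Semigroup S ∧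
        FreeWave.IsGenerator S (FreeWave.freeWaveOp h).closure ∧
        ∀ (τ : NNReal) (u : FreeWave.EnergySpace h),
          ‖S τ u‖ ≤ Real.exp (((n : ℝ) / 2 - 1 - s₁) * τ) * ‖u‖ := by
  intro h
  have hs : s₁ ≤ s₂ := by linarith
  obtain ⟨h1, h2, h3⟩ := FreeWave.freeWave_generates h hs₁ hs
  exact ⟨h2, FreeWave.energyEvol h hs₁ hs, h1, h3, FreeWave.norm_energyEvol_le h hs₁ hs⟩
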